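/- An XOR-clause is a linear equation $x_{i_1}+\dots+x_{i_k}=\varepsilon$ over the two-element field, with $\varepsilon\in\{0,1\}$, and an XOR-CNF is a finite sequence $\varphi=(C_1,\dots,C_m)$ of XOR-clauses. A signature of $\varphi$ is a binary sequence $(C_1(\mathbf a),\dots,C_m(\mathbf a))\in\{0,1\}^m$, where $\mathbf a$ is a $0/1$-assignment of the variables and $C_i(\mathbf a)=1$ if $\mathbf a$ satisfies $C_i$, $C_i(\mathbf a)=0$ otherwise. Theorem. The set of signatures of an XOR-CNF formula can be enumerated with polynomial delay and polynomial space. That is, there are a random access machine (with addition and truncated subtraction) and two polynomials $d$ and $s$ such that, for every XOR-CNF $\varphi$, with input size $N$ (the length of $\varphi$ in bits, variable indices being written in binary), the machine on input $\varphi$ outputs each signature of $\varphi$ exactly once, outputs nothing else, and halts; the number of steps before the first output, between two consecutive outputs, and from the last output to halting is at most $d(N)$; and at every time its memory (not counting the solutions already output) takes at most $s(N)$ bits. -/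

import Mathlib

/-! ### XOR-CNF formulas and their signatures -/

/-- An XOR-clause, written as a linear equation `x₁ + ⋯ + x_k = ε` over the two-element field.
Variables are named by natural numbers. A variable listed several times is added that often. -/
structure XorClause where
  vars : List ℕ
  rhs : ZMod 2

/-- An XOR-CNF `C₁ ∧ ⋯ ∧ C_m`, given as the sequence of its clauses
(empty and repeated clauses are allowed). -/
abbrev XorCNF := List XorClause

/-- The clause evaluates to 1 under the assignment `a`. -/
def XorClause.Sat (C : XorClause) (a : ℕ → ZMod 2) : Prop :=
  (C.vars.map a).sum = C.rhs

instance (C : XorClause) (a : ℕ → ZMod 2) : Decidable (C.Sat a) :=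
  inferInstanceAs (Decidable (_ = _))

/-- The signature `(C₁(a), …, C_m(a))` produced by the assignment `a`. Only the values of `a` on
the variables that occur in `φ` matter. -/
def XorCNF.signature (φ : XorCNF) (a : ℕ → ZMod 2) : List Bool :=
  φ.map fun C => decide (C.Sat a)

/-- The set of all signatures of `φ`. -/
def XorCNF.signatures (φ : XorCNF) : Set (List Bool) :=
  Set.range φ.signature

/-- A clause as input for a machine: right-hand side, number of variables, variables. -/
def XorClause.encode (C : XorClause) : List ℕ :=
  C.rhs.val :: C.vars.length :: C.vars

/-- A formula as input for a machine: number of clauses, then the clauses one after the other. -/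
def XorCNF.encode (φ : XorCNF) : List ℕ :=
  φ.length :: φ.flatMap XorClause.encode

/-! ### Random access machines with an output device

The memory consists of cells that hold natural numbers. A cell is addressed by the name `a` of an
array (a constant of the program) and an index `i` (which may be computed). Scalar variables are
cells with a constant index. The arithmetic is addition and truncated subtraction. -/

namespace RAM

/-- Memory contents; all but finitely many cells contain 0. -/
abbrev Mem := ℕ × ℕ →₀ ℕ

/-- Expressions. -/
inductive Expr where
  /-- a constant -/
  | lit (n : ℕ)
  /-- the content of the cell of array `a` whose index is the value of `i` -/
  | cell (a : ℕ) (i : Expr)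
  | add (e f : Expr)
  | sub (e f : Expr)

/-- The value of an expression. -/
def Expr.eval (M : Mem) : Expr → ℕ
  | lit n => n
  | cell a i => M (a, i.eval M)
  | add e f => e.eval M + f.eval M
  | sub e f => e.eval M - f.eval M

/-- Programs. -/
inductive Prog where
  | skip
  /-- store the value of `e` in the cell of array `a` whose index is the value of `i` -/
  | store (a : ℕ) (i e : Expr)
  | seq (P Q : Prog)
  /-- run `P` if `e` is nonzero, and `Q` otherwise -/
  | ite (e : Expr) (P Q : Prog)
  /-- repeat `P` as long as `e` is nonzero -/
  | loop (e : Expr) (P : Prog)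
  /-- append one bit (1 if `e` is nonzero, 0 otherwise) to the solution that is being written -/
  | write (e : Expr)
  /-- the solution that is being written is complete: output it and start a new, empty one -/
  | emit

/-- Configurations: what is left to execute (for a fixed program this takes only finitely many
values), the memory, the bits of the solution being written, and the solutions output so far.
The machine cannot read `buf` and `out`. -/
structure Config where
  code : List Prog
  mem : Mem
  buf : List Bool
  out : List (List Bool)

/-- One step of computation; a configuration with nothing left to execute has halted. -/
noncomputable def step : Config → Config
  | ⟨[], M, b, o⟩ => ⟨[], M, b, o⟩
  | ⟨.skip :: k, M, b, o⟩ => ⟨k, M, b, o⟩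
  | ⟨.store a i e :: k, M, b, o⟩ => ⟨k, M.update (a, i.eval M) (e.eval M), b, o⟩
  | ⟨.seq P Q :: k, M, b, o⟩ => ⟨P :: Q :: k, M, b, o⟩
  | ⟨.ite e P Q :: k, M, b, o⟩ => ⟨(if e.eval M ≠ 0 then P else Q) :: k, M, b, o⟩
  | ⟨.loop e P :: k, M, b, o⟩ => ⟨if e.eval M ≠ 0 then P :: .loop e P :: k else k, M, b, o⟩
  | ⟨.write e :: k, M, b, o⟩ => ⟨k, M, b ++ [decide (e.eval M ≠ 0)], o⟩
  | ⟨.emit :: k, M, b, o⟩ => ⟨k, M, [], o ++ [b]⟩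

/-- The memory whose array 0 contains the word `w`, all other cells being 0. -/
noncomputable def inputMem (w : List ℕ) : Mem :=
  Finsupp.onFinset ({0} ×ˢ Finset.range w.length)
    (fun c => if c.1 = 0 then w.getD c.2 0 else 0)
    (by
      rintro ⟨a, i⟩ h
      by_cases ha : a = 0 <;> by_cases hi : i < w.length <;> simp_all)

/-- The configuration of the program `P` on input `w` after `t` steps. -/
noncomputable def run (P : Prog) (w : List ℕ) (t : ℕ) : Config :=
  step^[t] ⟨[P], inputMem w, [], []⟩

/-- The machine has halted. -/
def Config.Halted (c : Config) : Prop := c.code = []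

/-- The space in use, in bits: the total binary length of the contents and of the addresses of all
cells that are not 0. (The input counts; solutions that have been output do not.) -/
def Config.space (c : Config) : ℕ :=
  c.mem.sum fun x v => Nat.size x.1 + Nat.size x.2 + Nat.size v

/-- The size of an input, in bits (with one additional bit per number as a separator). -/
def inputSize (w : List ℕ) : ℕ := (w.map fun n => Nat.size n + 1).sum

/-- `P` enumerates the set `S` on input `w`: it halts after having output each element of `S`
exactly once and nothing else. -/
def Enumerates (P : Prog) (w : List ℕ) (S : Set (List Bool)) : Prop :=
  ∃ T, (run P w T).Halted ∧ (run P w T).out.Nodup ∧ {s | s ∈ (run P w T).out} = S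

/-- The delay of `P` on input `w` is at most `D`: from any time on, within `D` steps there is a
further output or the machine has halted. This bounds the time before the first output, between
consecutive outputs, and between the last output and halting. -/
def DelayAtMost (P : Prog) (w : List ℕ) (D : ℕ) : Prop :=
  ∀ t, (run P w t).out.length < (run P w (t + D)).out.length ∨ (run P w (t + D)).Halted

/-- The space used by `P` on input `w` is never more than `s` bits. -/
def SpaceAtMost (P : Prog) (w : List ℕ) (s : ℕ) : Prop :=
  ∀ t, (run P w t).space ≤ s

/-- An enumeration problem (instances of type `α`, presented to the machine through `enc`, with
solution sets `sols`) can be solved with polynomial delay and polynomial space: one program solves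
all the instances, with delay and space bounded by polynomials in the size of the input. Since a
memory cell holds only polynomially many bits then, counting every instruction as one step is
polynomially equivalent to counting bit operations. -/
def EnumerableWithPolyDelayPolySpace {α : Type} (enc : α → List ℕ) (sols : α → Set (List Bool)) :
    Prop :=
  ∃ (P : Prog) (d s : Polynomial ℕ), ∀ x : α,
    Enumerates P (enc x) (sols x) ∧
    DelayAtMost P (enc x) (d.eval (inputSize (enc x))) ∧
    SpaceAtMost P (enc x) (s.eval (inputSize (enc x)))

end RAM

/-! Over the two-element field a clause with right-hand side ε holds iff 1 + ε + (sum of its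
variables) is 1. Hence the signatures form an affine space: a fixed vector `base` plus the span of
the columns of the coefficient matrix (`signatures_eq`). Inserting the columns one by one, each
reduced at the pivots found so far, gives a triangular basis of r vectors in polynomial time
(`prepare_spec`). Each K < 2^r then yields one signature, the binary digits of K being the
coefficients. Independence excludes repetitions (`nthSignature_nodup`), spanning excludes omissions
(`mem_nthSignature_iff`), and each signature is computed afresh from the counter K
(`outputNext_spec`). As the machine only adds and subtracts, the row positions i * m and the powers
2^i are tabulated along with the basis.

`WP` is total correctness with a time bound polynomial in the maximal length of the loops. It covers
everything except the main loop, whose 2^r rounds are exponentially many, so that neither delay nor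
space follows from a total running time. The computation is therefore cut into segments: the
preparation, one segment per signature, and the exit. One step adds at most one cell and a constant
number of bits to each length, so a short segment cannot use much space provided it starts from a
small memory (`iterate_step_bounded`). The invariant `Enumerated` supplies this with a bound
independent of K: compared with the memory after the preparation, only boundedly placed cells have
changed, and their contents are at most 2^N. Every signature segment makes an output, hence the
delay is at most two segments (`Segmented.prepend`). -/

namespace RAM

/-! ### Program logic for random access machines -/

/-- A configuration without its code. -/
structure State where
  mem : Mem
  buf : List Bool
  out : List (List Bool)

/-- The configuration that executes the code `k` from the state `s`. -/
def State.config (s : State) (k : List Prog) : Config := ⟨k, s.mem, s.buf, s.out⟩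

/-- Store `v` in the cell of array `a` with index `i`. -/
noncomputable def State.set (s : State) (a i v : ℕ) : State :=
  { s with mem := s.mem.update (a, i) v }

@[simp] theorem State.set_mem (s : State) (a i v a' i' : ℕ) :
    (s.set a i v).mem (a', i') = if a' = a ∧ i' = i then v else s.mem (a', i') := by
  simp [State.set, Function.update_apply]

@[simp] theorem State.set_buf (s : State) (a i v : ℕ) : (s.set a i v).buf = s.buf := rfl

@[simp] theorem State.set_out (s : State) (a i v : ℕ) : (s.set a i v).out = s.out := rfl

/-- The arrays that a program may write to. -/
def Prog.arrays : Prog → List ℕ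
  | store a _ _ => [a]
  | seq P Q => P.arrays ++ Q.arrays
  | ite _ P Q => P.arrays ++ Q.arrays
  | loop _ P => P.arrays
  | _ => []

/-- The arrays that a program may write to with an index other than the constant 0. -/
def Prog.indexed : Prog → List ℕ
  | store _ (.lit 0) _ => []
  | store a _ _ => [a]
  | seq P Q => P.indexed ++ Q.indexed
  | ite _ P Q => P.indexed ++ Q.indexed
  | loop _ P => P.indexed
  | _ => []

/-- The program does not use the output device. -/
def Prog.silent : Prog → Bool
  | seq P Q => P.silent && Q.silent
  | ite _ P Q => P.silent && Q.silent
  | loop _ P => P.silent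
  | write _ => false
  | emit => false
  | _ => true

/-- The part of the state that `P` cannot change is the same in `s` and in `s'`. -/
structure Frame (P : Prog) (s s' : State) : Prop where
  mem : ∀ a, a ∉ P.arrays → ∀ i, s'.mem (a, i) = s.mem (a, i)
  scalar : ∀ a, a ∉ P.indexed → ∀ i, i ≠ 0 → s'.mem (a, i) = s.mem (a, i)
  buf : P.silent = true → s'.buf = s.buf
  out : P.silent = true → s'.out = s.out

theorem Frame.refl (P : Prog) (s : State) : Frame P s s :=
  ⟨fun _ _ _ => rfl, fun _ _ _ _ => rfl, fun _ => rfl, fun _ => rfl⟩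

theorem Frame.trans {P : Prog} {s s' s'' : State} (h : Frame P s s') (h' : Frame P s' s'') :
    Frame P s s'' :=
  ⟨fun a ha i => (h'.mem a ha i).trans (h.mem a ha i),
    fun a ha i hi => (h'.scalar a ha i hi).trans (h.scalar a ha i hi),
    fun hP => (h'.buf hP).trans (h.buf hP), fun hP => (h'.out hP).trans (h.out hP)⟩

theorem Frame.weaken {P Q : Prog} {s s' : State} (h : Frame P s s')
    (h₁ : P.arrays ⊆ Q.arrays) (h₂ : P.indexed ⊆ Q.indexed)
    (h₃ : Q.silent = true → P.silent = true) : Frame Q s s' :=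
  ⟨fun a ha => h.mem a fun h => ha (h₁ h), fun a ha => h.scalar a fun h => ha (h₂ h),
    fun hQ => h.buf (h₃ hQ), fun hQ => h.out (h₃ hQ)⟩

/-- The running time of a program all of whose loops are repeated at most `X` times. -/
noncomputable def Prog.time : Prog → Polynomial ℕ
  | seq P Q => P.time + Q.time + 1
  | ite _ P Q => P.time + Q.time + 1
  | loop _ P => .X * (P.time + 1) + 1
  | _ => 1

/-- From the state `s` the program `P` terminates within the time allotted by `Prog.time` for
loops of length at most `N`, in a state that satisfies `Q`. -/
def WP (N : ℕ) (P : Prog) (Q : State → Prop) (s : State) : Prop :=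
  ∃ t ≤ P.time.eval N, ∃ s', Q s' ∧ Frame P s s' ∧
    ∀ k, step^[t] (s.config (P :: k)) = s'.config k

/-- The consequence rule hands the frame condition to the postcondition. Specifications can thus
omit what a program leaves alone; `decide` recovers it from the syntactic list of arrays. -/
theorem WP.mono {N : ℕ} {P : Prog} {Q Q' : State → Prop} {s : State} (h : WP N P Q s)
    (hQ : ∀ s', Frame P s s' → Q s' → Q' s') : WP N P Q' s := by
  obtain ⟨t, ht, s', h₁, h₂, h₃⟩ := h
  exact ⟨t, ht, s', hQ s' h₂ h₁, h₂, h₃⟩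

theorem WP.skip {N : ℕ} {Q : State → Prop} {s : State} (h : Q s) : WP N .skip Q s :=
  ⟨1, by simp [Prog.time], s, h, .refl _ _, fun _ => rfl⟩

theorem WP.store {N : ℕ} {Q : State → Prop} {s : State} {a : ℕ} {i e : Expr}
    (h : Q (s.set a (i.eval s.mem) (e.eval s.mem))) : WP N (.store a i e) Q s := by
  refine ⟨1, by simp [Prog.time], _, h, ⟨fun b hb j => ?_, fun b hb j hj => ?_,
    fun _ => rfl, fun _ => rfl⟩, fun _ => rfl⟩
  · have : b ≠ a := by simpa [Prog.arrays] using hb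
    simp [this]
  · rw [State.set_mem, if_neg]
    rintro ⟨rfl, rfl⟩
    unfold Prog.indexed at hb
    split at hb
    · rename_i h
      cases h
      exact hj rfl
    · rename_i h
      cases h
      simp at hb
    all_goals simp_all

theorem WP.write {N : ℕ} {Q : State → Prop} {s : State} {e : Expr}
    (h : Q { s with buf := s.buf ++ [decide (e.eval s.mem ≠ 0)] }) : WP N (.write e) Q s :=
  ⟨1, by simp [Prog.time], _, h, ⟨fun _ _ _ => rfl, fun _ _ _ _ => rfl,
    fun h => by simp [Prog.silent] at h, fun h => by simp [Prog.silent] at h⟩, fun _ => rfl⟩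

theorem WP.emit {N : ℕ} {Q : State → Prop} {s : State}
    (h : Q { s with buf := [], out := s.out ++ [s.buf] }) : WP N .emit Q s :=
  ⟨1, by simp [Prog.time], _, h, ⟨fun _ _ _ => rfl, fun _ _ _ _ => rfl,
    fun h => by simp [Prog.silent] at h, fun h => by simp [Prog.silent] at h⟩, fun _ => rfl⟩

theorem WP.seq {N : ℕ} {P P' : Prog} {Q : State → Prop} {s : State}
    (h : WP N P (WP N P' Q) s) : WP N (.seq P P') Q s := by
  obtain ⟨t, ht, s₁, ⟨t', ht', s₂, hQ, hF', h'⟩, hF, h⟩ := h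
  refine ⟨t' + (t + 1), ?_, s₂, hQ, .trans (hF.weaken ?_ ?_ ?_) (hF'.weaken ?_ ?_ ?_), fun k => ?_⟩
  · simp only [Prog.time, Polynomial.eval_add, Polynomial.eval_one]
    omega
  · simp [Prog.arrays]
  · simp [Prog.indexed]
  · simp +contextual [Prog.silent]
  · simp [Prog.arrays]
  · simp [Prog.indexed]
  · simp +contextual [Prog.silent]
  · rw [Function.iterate_add_apply, Function.iterate_succ_apply, ← h' k, ← h (P' :: k)]
    rfl

theorem WP.ite {N : ℕ} {P P' : Prog} {Q : State → Prop} {s : State} {e : Expr}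
    (h : e.eval s.mem ≠ 0 → WP N P Q s) (h' : e.eval s.mem = 0 → WP N P' Q s) :
    WP N (.ite e P P') Q s := by
  by_cases he : e.eval s.mem = 0
  · obtain ⟨t, ht, s', hQ, hF, h⟩ := h' he
    refine ⟨t + 1, ?_, s', hQ, hF.weaken ?_ ?_ ?_, fun k => ?_⟩
    · simp only [Prog.time, Polynomial.eval_add, Polynomial.eval_one]
      omega
    · simp [Prog.arrays]
    · simp [Prog.indexed]
    · simp +contextual [Prog.silent]
    · rw [Function.iterate_succ_apply, ← h k]
      simp [State.config, step, he]
  · obtain ⟨t, ht, s', hQ, hF, h⟩ := h he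
    refine ⟨t + 1, ?_, s', hQ, hF.weaken ?_ ?_ ?_, fun k => ?_⟩
    · simp only [Prog.time, Polynomial.eval_add, Polynomial.eval_one]
      omega
    · simp [Prog.arrays]
    · simp [Prog.indexed]
    · simp +contextual [Prog.silent]
    · rw [Function.iterate_succ_apply, ← h k]
      simp [State.config, step, he]

/-- A loop that decreases the value of its guard by one in each of at most `N` rounds. -/
theorem WP.loop {N n : ℕ} {P : Prog} {Q : State → Prop} {s : State} {e : Expr}
    (I : ℕ → State → Prop) (hn : n ≤ N) (h₀ : I 0 s)
    (he : ∀ k ≤ n, ∀ s', Frame P s s' → I k s' → e.eval s'.mem = n - k)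
    (hstep : ∀ k < n, ∀ s', Frame P s s' → I k s' → WP N P (I (k + 1)) s')
    (hQ : ∀ s', Frame P s s' → I n s' → Q s') : WP N (.loop e P) Q s := by
  -- Induction on the number d of remaining rounds. A round costs one step for the guard besides the
  -- body, and one last step leaves the loop.
  have key : ∀ d ≤ n, ∀ s', Frame P s s' → I (n - d) s' →
      ∃ t ≤ d * (P.time.eval N + 1) + 1, ∃ s'', Q s'' ∧ Frame P s s'' ∧
        ∀ k, step^[t] (s'.config (.loop e P :: k)) = s''.config k := by
    intro d
    induction d with
    | zero =>
      intro _ s' hF hI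
      refine ⟨1, by simp, s', hQ s' hF hI, hF, fun k => ?_⟩
      simp [State.config, step, he n le_rfl s' hF hI]
    | succ d ih =>
      intro hd s' hF hI
      obtain ⟨t, ht, s₁, hI₁, hF₁, h₁⟩ := hstep (n - (d + 1)) (by omega) s' hF hI
      rw [show n - (d + 1) + 1 = n - d by omega] at hI₁
      obtain ⟨t', ht', s₂, hQ₂, hF₂, h₂⟩ := ih (by omega) s₁ (hF.trans hF₁) hI₁
      refine ⟨t' + (t + 1), ?_, s₂, hQ₂, hF₂, fun k => ?_⟩
      · rw [Nat.succ_mul]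
        omega
      · have := he (n - (d + 1)) (by omega) s' hF hI
        rw [Function.iterate_add_apply, Function.iterate_succ_apply, ← h₂ k, ← h₁]
        congr 2
        simp only [State.config, step]
        rw [if_pos (by omega)]
  obtain ⟨t, ht, s', hQ', hF, h⟩ := key n le_rfl s (.refl _ _) (by simpa using h₀)
  -- A loop has by definition the same `arrays`, `indexed` and `silent` as its body, so the fields
  -- of the frame carry over unchanged.
  refine ⟨t, ht.trans ?_, s', hQ', ⟨hF.mem, hF.scalar, hF.buf, hF.out⟩, h⟩
  simp only [Prog.time, Polynomial.eval_add, Polynomial.eval_mul, Polynomial.eval_X,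
    Polynomial.eval_one]
  gcongr

/-- The scalar variable `a`. -/
abbrev Expr.var (a : ℕ) : Expr := .cell a (.lit 0)

/-- Assign the value of `e` to the scalar variable `a`. -/
abbrev Prog.assign (a : ℕ) (e : Expr) : Prog := .store a (.lit 0) e

/-- Run `P` for the values `0, …, e - 1` of the scalar variable `i`. -/
def Prog.forLoop (i : ℕ) (e : Expr) (P : Prog) : Prog :=
  .seq (.assign i (.lit 0))
    (.loop (.sub e (.var i)) (.seq P (.assign i (.add (.var i) (.lit 1)))))

theorem WP.assign {N : ℕ} {Q : State → Prop} {s : State} {a : ℕ} {e : Expr}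
    (h : Q (s.set a 0 (e.eval s.mem))) : WP N (.assign a e) Q s := WP.store h

/-- The bound `e` is evaluated again in each round, so its value must be n in all states that the
loop can reach. The invariant for k + 1 is demanded after the counter has been incremented. -/
theorem WP.forLoop {N n i : ℕ} {P : Prog} {Q : State → Prop} {s : State} {e : Expr}
    (I : ℕ → State → Prop) (hn : n ≤ N) (hi : i ∉ P.arrays) (h₀ : I 0 (s.set i 0 0))
    (he : ∀ s', Frame (.forLoop i e P) s s' → e.eval s'.mem = n)
    (hstep : ∀ k < n, ∀ s', Frame (.forLoop i e P) s s' → I k s' → s'.mem (i, 0) = k →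
      WP N P (fun s'' => I (k + 1) (s''.set i 0 (k + 1))) s')
    (hQ : ∀ s', Frame (.forLoop i e P) s s' → I n s' → Q s') :
    WP N (.forLoop i e P) Q s := by
  have hF₀ : Frame (.forLoop i e P) s (s.set i 0 0) := by
    refine ⟨fun a ha j => ?_, fun a ha j hj => ?_, fun _ => rfl, fun _ => rfl⟩
    · simp only [Prog.forLoop, Prog.arrays, List.mem_append, List.mem_singleton, not_or] at ha
      simp [ha.1]
    · simp [hj]
  have hF : ∀ s', Frame (.seq P (.assign i (.add (.var i) (.lit 1)))) (s.set i 0 0) s' →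
      Frame (.forLoop i e P) s s' := fun s' h => hF₀.trans
    (h.weaken (by simp [Prog.forLoop, Prog.arrays]) (by simp [Prog.forLoop, Prog.indexed])
      (by simp [Prog.forLoop, Prog.silent]))
  refine WP.seq (WP.assign (WP.loop (n := n) (fun k s' => I k s' ∧ s'.mem (i, 0) = k) hn
    ⟨by simpa [Expr.eval] using h₀, by simp [Expr.eval]⟩ ?_ ?_ ?_))
  · intro k _ s' h hI
    simp only [Expr.eval, he s' (hF s' h), hI.2]
  · intro k hk s' h hI
    refine WP.seq ((hstep k hk s' (hF s' h) hI.1 hI.2).mono fun s'' h'' hI'' => WP.assign ?_)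
    have : s''.mem (i, 0) = k := (h''.mem i hi 0).trans hI.2
    simpa [Expr.eval, this] using hI''
  · exact fun s' h hI => hQ s' (hF s' h) hI.1

end RAM

namespace RAM

/-! ### Growth of the memory -/

/-- A bound for the number of bits by which the value of an expression is longer than the contents
of the memory. -/
def Expr.growth : Expr → ℕ
  | lit n => Nat.size n
  | cell _ _ => 0
  | add e f => e.growth + f.growth + 1
  | sub e _ => e.growth

theorem size_add_le {a b n : ℕ} (ha : Nat.size a ≤ n) (hb : Nat.size b ≤ n) :
    Nat.size (a + b) ≤ n + 1 := by
  rw [Nat.size_le] at *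
  rw [pow_succ]
  omega

/-- Only literals and additions create length, an addition one bit beyond its operands; a cell,
however its index is computed, is covered by the bound for the memory. -/
theorem Expr.size_eval_le {M : Mem} {B : ℕ} (h : ∀ x, Nat.size (M x) ≤ B) (e : Expr) :
    Nat.size (e.eval M) ≤ B + e.growth := by
  induction e with
  | lit n => simp [Expr.eval, Expr.growth]
  | cell a i _ => exact (h _).trans (by simp [Expr.growth])
  | add e f he hf =>
    simp only [Expr.eval, Expr.growth]
    refine (size_add_le (n := B + e.growth + f.growth) ?_ ?_).trans ?_ <;> omega
  | sub e f he _ => exact (Nat.size_le_size (Nat.sub_le _ _)).trans he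

/-- A bound for the number of bits by which one step of a program can lengthen the contents and
the addresses of the cells. -/
def Prog.growth : Prog → ℕ
  | store a i e => Nat.size a + i.growth + e.growth
  | seq P Q => P.growth + Q.growth
  | ite _ P Q => P.growth + Q.growth
  | loop _ P => P.growth
  | _ => 0

/-- At most `A` cells are in use, and their addresses and contents have at most `B` bits. -/
structure Bounded (A B : ℕ) (M : Mem) : Prop where
  card : M.support.card ≤ A
  array : ∀ x, M x ≠ 0 → Nat.size x.1 ≤ B
  index : ∀ x, M x ≠ 0 → Nat.size x.2 ≤ B
  value : ∀ x, Nat.size (M x) ≤ B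

theorem Bounded.mono {A B A' B' : ℕ} {M : Mem} (h : Bounded A B M) (hA : A ≤ A') (hB : B ≤ B') :
    Bounded A' B' M :=
  ⟨h.card.trans hA, fun x hx => (h.array x hx).trans hB, fun x hx => (h.index x hx).trans hB,
    fun x => (h.value x).trans hB⟩

theorem Bounded.space_le {A B : ℕ} {c : Config} (h : Bounded A B c.mem) :
    c.space ≤ A * (3 * B) := by
  refine (Finset.sum_le_card_nsmul _ _ (3 * B) fun x hx => ?_).trans ?_
  · have hx := Finsupp.mem_support_iff.1 hx
    have := h.array x hx
    have := h.index x hx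
    have := h.value x
    dsimp only
    omega
  · rw [smul_eq_mul]
    exact Nat.mul_le_mul_right _ h.card

theorem Bounded.update {A B a i v : ℕ} {M : Mem} (h : Bounded A B M) (ha : Nat.size a ≤ B)
    (hi : Nat.size i ≤ B) (hv : Nat.size v ≤ B) : Bounded (A + 1) B (M.update (a, i) v) := by
  classical
  have key : ∀ x, (M.update (a, i) v) x ≠ 0 → x = (a, i) ∨ M x ≠ 0 := by
    intro x hx
    by_cases hxa : x = (a, i)
    · exact .inl hxa
    · right
      simpa [Function.update_apply, hxa] using hx
  refine ⟨?_, fun x hx => ?_, fun x hx => ?_, fun x => ?_⟩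
  · refine (Finset.card_le_card (t := insert (a, i) M.support) fun x hx => ?_).trans
      ((Finset.card_insert_le _ _).trans (Nat.add_le_add_right h.card 1))
    simpa using key x (Finsupp.mem_support_iff.1 hx)
  · rcases key x hx with rfl | hx
    exacts [ha, h.array x hx]
  · rcases key x hx with rfl | hx
    exacts [hi, h.index x hx]
  · simp only [Finsupp.coe_update, Function.update_apply]
    split_ifs
    exacts [hv, h.value x]

/-- The code is part of the induction: a step replaces a program by parts of itself, whose growth is
no larger, so the constant g serves for the whole run. -/
theorem step_bounded {A B g : ℕ} {c : Config} (h : Bounded A B c.mem)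
    (hg : ∀ P ∈ c.code, P.growth ≤ g) :
    Bounded (A + 1) (B + g) (step c).mem ∧ ∀ P ∈ (step c).code, P.growth ≤ g := by
  have h' : Bounded (A + 1) (B + g) c.mem := h.mono (by omega) (by omega)
  obtain ⟨code, M, b, o⟩ := c
  cases code with
  | nil => exact ⟨h', hg⟩
  | cons P k =>
    simp only [List.forall_mem_cons] at hg
    obtain ⟨hP, hk⟩ := hg
    cases P with
    | skip => exact ⟨h', hk⟩
    | store a i e =>
      simp only [Prog.growth] at hP
      have hi := i.size_eval_le h.value
      have he := e.size_eval_le h.value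
      exact ⟨(h.mono le_rfl (by omega)).update (by omega) (hi.trans (by omega))
        (he.trans (by omega)), hk⟩
    | seq P Q =>
      simp only [Prog.growth] at hP
      refine ⟨h', ?_⟩
      simp only [step, List.forall_mem_cons]
      exact ⟨by omega, by omega, hk⟩
    | ite e P Q =>
      simp only [Prog.growth] at hP
      refine ⟨h', ?_⟩
      simp only [step, List.forall_mem_cons]
      exact ⟨by split_ifs <;> omega, hk⟩
    | loop e P =>
      simp only [Prog.growth] at hP
      refine ⟨h', ?_⟩
      simp only [step]
      split_ifs
      · simp only [List.forall_mem_cons]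
        exact ⟨hP, by simpa [Prog.growth] using hP, hk⟩
      · exact hk
    | write e => exact ⟨h', hk⟩
    | emit => exact ⟨h', hk⟩

theorem iterate_step_bounded {A B g : ℕ} {c : Config} (h : Bounded A B c.mem)
    (hg : ∀ P ∈ c.code, P.growth ≤ g) (t : ℕ) :
    Bounded (A + t) (B + t * g) (step^[t] c).mem ∧
      ∀ P ∈ (step^[t] c).code, P.growth ≤ g := by
  induction t with
  | zero => simpa using ⟨h, hg⟩
  | succ t ih =>
    rw [Function.iterate_succ_apply', Nat.succ_mul, ← Nat.add_assoc, ← Nat.add_assoc]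
    exact step_bounded ih.1 ih.2

/-! ### Delay and space of a computation that consists of short segments -/

theorem length_out_le_step (c : Config) : c.out.length ≤ (step c).out.length := by
  obtain ⟨code, M, b, o⟩ := c
  rcases code with _ | ⟨_ | _ | _ | _ | _ | _ | _, k⟩ <;> simp [step]

theorem length_out_mono (c : Config) : Monotone fun t => (step^[t] c).out.length :=
  monotone_nat_of_le_succ fun t => by
    simpa only [Function.iterate_succ_apply'] using length_out_le_step _

theorem iterate_step_of_halted {c : Config} (h : c.Halted) (t : ℕ) : step^[t] c = c := by
  have : step c = c := by
    obtain ⟨code, M, b, o⟩ := c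
    obtain rfl : code = [] := h
    rfl
  exact Function.iterate_fixed this t

/-- From the configuration `c` on, the machine outputs so as to end with the list `o`; it proceeds
in segments of length at most `D`, and uses space at most `S`. -/
structure Segmented (D S : ℕ) (o : List (List Bool)) (c : Config) : Prop where
  halts : ∃ T, (step^[T] c).Halted ∧ (step^[T] c).out = o
  delay : ∀ t, (step^[t] c).out.length < (step^[t + 2 * D] c).out.length ∨
    (step^[t + 2 * D] c).Halted
  space : ∀ t, (step^[t] c).space ≤ S

/-- Within `D` steps there is an output, or the machine has halted. -/
def Progress (D : ℕ) (c : Config) : Prop :=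
  ∃ t ≤ D, c.out.length < (step^[t] c).out.length ∨ (step^[t] c).Halted

theorem Config.Halted.iterate_of_le {c : Config} {t t' : ℕ} (h : (step^[t] c).Halted)
    (ht : t ≤ t') :
    (step^[t'] c).Halted := by
  obtain ⟨d, rfl⟩ := Nat.exists_eq_add_of_le' ht
  rwa [Function.iterate_add_apply, iterate_step_of_halted h]

theorem Segmented.of_halted {D S : ℕ} {c : Config} (h : c.Halted) (hS : c.space ≤ S) :
    Segmented D S c.out c where
  halts := ⟨0, h, rfl⟩
  delay t := .inr (by rwa [iterate_step_of_halted h])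
  space t := by rwa [iterate_step_of_halted h]

/-- From a time inside the first segment, at most D steps lead to its end and at most D more to the
progress made after it; this is the factor 2 in the delay. The space inside the segment is bounded
by its length, starting from the bounds A and B. -/
theorem Segmented.prepend {D A B g n : ℕ} {o : List (List Bool)} {c : Config}
    (hn : n ≤ D) (hc : Bounded A B c.mem) (hg : ∀ P ∈ c.code, P.growth ≤ g)
    (h : Segmented D ((A + D) * (3 * (B + D * g))) o (step^[n] c))
    (hp : Progress D (step^[n] c)) :
    Segmented D ((A + D) * (3 * (B + D * g))) o c where
  halts := by
    obtain ⟨T, h⟩ := h.halts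
    exact ⟨T + n, by rwa [Function.iterate_add_apply]⟩
  delay t := by
    rcases le_total n t with ht | ht
    · obtain ⟨d, rfl⟩ := Nat.exists_eq_add_of_le' ht
      rw [show d + n + 2 * D = d + 2 * D + n by omega]
      simpa only [Function.iterate_add_apply] using h.delay d
    · obtain ⟨t', ht', h'⟩ := hp
      rw [← Function.iterate_add_apply] at h'
      refine h'.imp (fun h' => ?_) fun h' => Config.Halted.iterate_of_le h' (by omega)
      exact (length_out_mono c ht).trans_lt (h'.trans_le (length_out_mono c (by omega)))
  space t := by
    rcases le_total n t with ht | ht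
    · obtain ⟨d, rfl⟩ := Nat.exists_eq_add_of_le' ht
      rw [Function.iterate_add_apply]
      exact h.space d
    · refine (iterate_step_bounded hc hg t).1.space_le.trans ?_
      gcongr <;> omega

end RAM

/-! ### Signatures as an affine space -/

namespace XorCNF

/-- The variables of the clause number `c`. -/
def varsAt (φ : XorCNF) (c : ℕ) : List ℕ := φ[c]?.elim [] XorClause.vars

/-- The column of the variable `x` in the coefficient matrix of `φ`. -/
def column (φ : XorCNF) (x : ℕ) : ℕ → ZMod 2 := fun c => ((φ.varsAt c).count x : ZMod 2)

/-- The signature of the zero assignment, as a vector. -/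
def base (φ : XorCNF) : ℕ → ZMod 2 := fun c => 1 + φ[c]?.elim 0 XorClause.rhs

/-- The first `m` entries of a vector as a sequence of bits. -/
def bits (m : ℕ) (u : ℕ → ZMod 2) : List Bool := (List.range m).map fun j => decide (u j ≠ 0)

/-- The left-hand sides of the clauses as linear forms in the assignment. -/
def lhs (φ : XorCNF) : (ℕ → ZMod 2) →ₗ[ZMod 2] (ℕ → ZMod 2) where
  toFun a c := ((φ.varsAt c).map a).sum
  map_add' a b := by
    funext c
    exact List.sum_map_add
  map_smul' r a := by
    funext c
    exact List.sum_map_mul_left (φ.varsAt c) a r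

theorem lhs_apply (φ : XorCNF) (a : ℕ → ZMod 2) (c : ℕ) :
    φ.lhs a c = ((φ.varsAt c).map a).sum := rfl

/-- The summand 1 in `base` turns "both sides agree" into "the entry is nonzero". -/
theorem signature_eq_bits (φ : XorCNF) (a : ℕ → ZMod 2) :
    φ.signature a = bits φ.length (φ.base + φ.lhs a) := by
  refine List.ext_getElem (by simp [signature, bits]) fun c h₁ h₂ => ?_
  have hc : c < φ.length := by simpa [signature] using h₁
  simp only [signature, bits, List.getElem_map, List.getElem_range, Pi.add_apply, base, lhs_apply,
    varsAt, List.getElem?_eq_getElem hc, Option.elim_some, XorClause.Sat]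
  have key : ∀ u v : ZMod 2, (u = v) ↔ 1 + v + u ≠ 0 := by decide
  exact decide_eq_decide.2 (key _ _)

theorem lhs_single (φ : XorCNF) (x : ℕ) : φ.lhs (Pi.single x 1) = φ.column x := by
  funext c
  rw [lhs_apply, column]
  induction φ.varsAt c with
  | nil => simp
  | cons y l ih =>
    rw [List.map_cons, List.sum_cons, ih, List.count_cons, Pi.single_apply, Nat.cast_add, add_comm]
    congr 1
    by_cases h : y = x <;> simp [h]

theorem mem_encode {φ : XorCNF} {c x : ℕ} (h : x ∈ φ.varsAt c) : x ∈ φ.encode := by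
  unfold varsAt at h
  rcases lt_or_ge c φ.length with hc | hc
  · rw [List.getElem?_eq_getElem hc] at h
    refine List.mem_cons_of_mem _ (List.mem_flatMap.2 ⟨_, List.getElem_mem hc, ?_⟩)
    exact List.mem_cons_of_mem _ (List.mem_cons_of_mem _ h)
  · simp [List.getElem?_eq_none hc] at h

theorem lhs_eq_sum (φ : XorCNF) (a : ℕ → ZMod 2) :
    φ.lhs a = ∑ x ∈ φ.encode.toFinset, a x • φ.column x := by
  funext c
  rw [lhs_apply, Finset.sum_list_map_count, Finset.sum_apply]
  refine (Finset.sum_subset (fun x hx => ?_) fun x _ hx => ?_).trans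
    (Finset.sum_congr rfl fun x _ => ?_)
  · rw [List.mem_toFinset] at hx ⊢
    exact mem_encode hx
  · rw [List.count_eq_zero_of_not_mem (by simpa using hx), zero_smul]
  · simp [column, mul_comm]

/-- All numbers in the input serve as candidate variables, including lengths and right-hand sides.
This is harmless, since a number that is no variable has the zero column, and it saves the machine
from listing the variables. -/
theorem range_lhs (φ : XorCNF) :
    LinearMap.range φ.lhs = Submodule.span (ZMod 2) (φ.column '' {x | x ∈ φ.encode}) := by
  apply le_antisymm
  · rintro _ ⟨a, rfl⟩
    rw [lhs_eq_sum]
    exact Submodule.sum_mem _ fun x hx => Submodule.smul_mem _ _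
      (Submodule.subset_span ⟨x, by simpa using hx, rfl⟩)
  · rw [Submodule.span_le]
    rintro _ ⟨x, -, rfl⟩
    exact ⟨_, φ.lhs_single x⟩

theorem signatures_eq (φ : XorCNF) :
    φ.signatures = (fun u => bits φ.length (φ.base + u)) ''
      (Submodule.span (ZMod 2) (φ.column '' {x | x ∈ φ.encode}) : Set (ℕ → ZMod 2)) := by
  rw [← range_lhs, LinearMap.coe_range, ← Set.range_comp]
  exact congrArg Set.range (funext fun a => φ.signature_eq_bits a)

/-! ### Layout of the input -/

/-- The position of clause number `c` in the input. -/
def offset (φ : XorCNF) (c : ℕ) : ℕ := 1 + ((φ.take c).flatMap XorClause.encode).length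

@[simp] theorem offset_zero (φ : XorCNF) : φ.offset 0 = 1 := rfl

theorem offset_length (φ : XorCNF) : φ.offset φ.length = φ.encode.length := by
  simp [offset, encode, add_comm]

theorem offset_succ (φ : XorCNF) {c : ℕ} (hc : c < φ.length) :
    φ.offset (c + 1) = φ.offset c + 2 + (φ.varsAt c).length := by
  simp only [offset, varsAt, List.take_succ_eq_append_getElem hc, List.getElem?_eq_getElem hc,
    Option.elim_some, List.flatMap_append, List.length_append, List.flatMap_singleton,
    XorClause.encode, List.length_cons]
  omega

theorem encode_getD_offset (φ : XorCNF) {c : ℕ} (hc : c < φ.length) (i : ℕ)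
    (hi : i < (φ[c]).encode.length) :
    φ.encode.getD (φ.offset c + i) 0 = (φ[c]).encode.getD i 0 := by
  have h : φ.encode = (φ.length :: (φ.take c).flatMap XorClause.encode) ++
      ((φ[c]).encode ++ (φ.drop (c + 1)).flatMap XorClause.encode) := by
    have h : φ.take c ++ φ[c] :: φ.drop (c + 1) = φ := by simp
    have := congrArg (List.flatMap XorClause.encode) h
    rw [List.flatMap_append, List.flatMap_cons] at this
    rw [encode, List.cons_append, this]
  rw [h, List.getD_append_right _ _ _ _ (by simp [offset]; omega),
    List.getD_append _ _ _ _ (by simp [offset] at *; omega)]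
  congr 1
  simp [offset]
  omega

/-- For a bit ε, the truncated difference 1 - ε represents 1 + ε in the field. -/
theorem encode_getD_rhs (φ : XorCNF) {c : ℕ} (hc : c < φ.length) :
    1 - φ.encode.getD (φ.offset c) 0 = (φ.base c).val := by
  have := φ.encode_getD_offset hc 0 (by simp [XorClause.encode])
  rw [add_zero] at this
  rw [this, base, List.getElem?_eq_getElem hc]
  simp only [XorClause.encode, List.getD_cons_zero, Option.elim_some]
  generalize φ[c].rhs = v
  revert v
  decide

theorem encode_getD_length (φ : XorCNF) {c : ℕ} (hc : c < φ.length) :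
    φ.encode.getD (φ.offset c + 1) 0 = (φ.varsAt c).length := by
  rw [φ.encode_getD_offset hc 1 (by simp [XorClause.encode]), varsAt, List.getElem?_eq_getElem hc]
  rfl

theorem encode_getD_var (φ : XorCNF) {c j : ℕ} (hc : c < φ.length)
    (hj : j < (φ.varsAt c).length) :
    φ.encode.getD (φ.offset c + 2 + j) 0 = (φ.varsAt c)[j] := by
  simp only [varsAt, List.getElem?_eq_getElem hc, Option.elim_some] at hj ⊢
  rw [add_assoc, add_comm 2 j,
    φ.encode_getD_offset hc (j + 2) (by simpa [XorClause.encode] using hj)]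
  simp [XorClause.encode, hj]

theorem length_le_length_encode (φ : XorCNF) : φ.length ≤ φ.encode.length := by
  rw [← φ.offset_length]
  have : ∀ c ≤ φ.length, c ≤ φ.offset c := by
    intro c
    induction c with
    | zero => simp
    | succ c ih =>
      intro hc
      have := ih (by omega)
      rw [φ.offset_succ hc]
      omega
  exact this _ le_rfl

theorem length_varsAt_le (φ : XorCNF) {c : ℕ} (hc : c < φ.length) :
    (φ.varsAt c).length ≤ φ.encode.length := by
  have h := φ.offset_succ hc
  have : φ.offset (c + 1) ≤ φ.encode.length := by
    rw [← φ.offset_length]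
    refine Nat.add_le_add_left ?_ 1
    rw [List.take_length]
    exact ((List.take_sublist _ _).flatMap _).length_le
  omega

end XorCNF

/-! ### Triangular families of vectors over the two-element field -/

/-- The vectors `e 0, …, e (r - 1)` have the pivots `p 0, …, p (r - 1)` below `m`, and each of
them vanishes at the pivots of the previous ones. -/
structure Triangular (m r : ℕ) (e : ℕ → ℕ → ZMod 2) (p : ℕ → ℕ) : Prop where
  lt : ∀ i < r, p i < m
  diag : ∀ i < r, e i (p i) = 1
  upper : ∀ i k, i < k → k < r → e k (p i) = 0

theorem Triangular.snoc {m r q : ℕ} {e : ℕ → ℕ → ZMod 2} {p : ℕ → ℕ} (h : Triangular m r e p)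
    {u : ℕ → ZMod 2} (hq : q < m) (hu : u q = 1) (hp : ∀ i < r, u (p i) = 0) :
    Triangular m (r + 1) (Function.update e r u) (Function.update p r q) := by
  refine ⟨fun i hi => ?_, fun i hi => ?_, fun i k hik hk => ?_⟩
  · rcases Nat.lt_succ_iff_lt_or_eq.1 hi with hi | rfl
    · simpa [hi.ne] using h.lt i hi
    · simpa using hq
  · rcases Nat.lt_succ_iff_lt_or_eq.1 hi with hi | rfl
    · simpa [hi.ne] using h.diag i hi
    · simpa using hu
  · rcases Nat.lt_succ_iff_lt_or_eq.1 hk with hk | rfl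
    · simpa [hk.ne, (hik.trans hk).ne] using h.upper i k hik hk
    · simpa [hik.ne] using hp i hik

/-- Evaluate the relation at the pivot of the vector number k: earlier coefficients vanish by
induction, and later vectors vanish at that pivot. -/
theorem Triangular.eq_zero {m r : ℕ} {e : ℕ → ℕ → ZMod 2} {p : ℕ → ℕ} (h : Triangular m r e p)
    (d : ℕ → ZMod 2) (hd : ∀ j < m, ∑ k ∈ Finset.range r, d k * e k j = 0) :
    ∀ k < r, d k = 0 := by
  intro k
  induction k using Nat.strong_induction_on with
  | _ k ih =>
    intro hk
    have := hd (p k) (h.lt k hk)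
    rwa [Finset.sum_eq_single k, h.diag k hk, mul_one] at this
    · intro i hi hik
      rcases hik.lt_or_gt with hik | hik
      · rw [ih i hik (hik.trans hk), zero_mul]
      · rw [h.upper k i hik (Finset.mem_range.1 hi), mul_zero]
    · exact fun hkr => absurd (Finset.mem_range.2 hk) hkr

/-- The sum of the vectors `e k` with `l ≤ k < r` over the binary digits `k` of `K` that are 1. -/
def digitSum (e : ℕ → ℕ → ZMod 2) (K l r : ℕ) : ℕ → ZMod 2 :=
  ∑ k ∈ Finset.Ico l r, ((K.testBit k).toNat : ZMod 2) • e k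

theorem digitSum_self (e : ℕ → ℕ → ZMod 2) (K r : ℕ) : digitSum e K r r = 0 := by
  simp [digitSum]

/-- Splitting off the lowest digit matches the decoding loop, which treats the digits from the top
down. -/
theorem digitSum_eq_add (e : ℕ → ℕ → ZMod 2) (K : ℕ) {l r : ℕ} (h : l < r) :
    digitSum e K l r = digitSum e K (l + 1) r + ((K.testBit l).toNat : ZMod 2) • e l := by
  rw [digitSum, Finset.sum_eq_sum_Ico_succ_bot h, add_comm]
  rfl

theorem Triangular.digitSum_injOn {m r : ℕ} {e : ℕ → ℕ → ZMod 2} {p : ℕ → ℕ}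
    (h : Triangular m r e p) {K K' : ℕ} (hK : K < 2 ^ r) (hK' : K' < 2 ^ r)
    (heq : ∀ j < m, digitSum e K 0 r j = digitSum e K' 0 r j) : K = K' := by
  have key := h.eq_zero
    (fun k => ((K.testBit k).toNat : ZMod 2) - ((K'.testBit k).toNat : ZMod 2)) fun j hj => by
      have := sub_eq_zero.2 (heq j hj)
      simpa [digitSum, Finset.sum_apply, ← Finset.sum_sub_distrib, sub_mul] using this
  refine Nat.eq_of_testBit_eq fun k => ?_
  rcases lt_or_ge k r with hk | hk
  · have := key k hk
    revert this
    cases K.testBit k <;> cases K'.testBit k <;> decide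
  · have hr : 2 ^ r ≤ 2 ^ k := Nat.pow_le_pow_right (by norm_num) hk
    rw [Nat.testBit_lt_two_pow (hK.trans_le hr), Nat.testBit_lt_two_pow (hK'.trans_le hr)]

theorem digitSum_mem_span (e : ℕ → ℕ → ZMod 2) (K r : ℕ) :
    digitSum e K 0 r ∈ Submodule.span (ZMod 2) (e '' Set.Iio r) :=
  Submodule.sum_mem _ fun k hk => Submodule.smul_mem _ _
    (Submodule.subset_span ⟨k, (Finset.mem_Ico.1 hk).2, rfl⟩)

/-- Coefficients in the two-element field are bits, so every linear combination is given by the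
binary digits of some K. -/
theorem exists_digitSum_eq {e : ℕ → ℕ → ZMod 2} {r : ℕ} {u : ℕ → ZMod 2}
    (hu : u ∈ Submodule.span (ZMod 2) (e '' Set.Iio r)) : ∃ K < 2 ^ r, digitSum e K 0 r = u := by
  have : (Set.Iio r : Set ℕ) = ((Finset.Ico 0 r : Finset ℕ) : Set ℕ) := by ext; simp
  rw [this, Submodule.mem_span_image_finset_iff_exists_fun'] at hu
  obtain ⟨c, rfl⟩ := hu
  refine ⟨Nat.ofBits fun i : Fin r => decide (c i ≠ 0), Nat.ofBits_lt_two_pow _, ?_⟩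
  refine Finset.sum_congr rfl fun k hk => ?_
  rw [Nat.testBit_ofBits_lt _ _ (Finset.mem_Ico.1 hk).2]
  congr 1
  simp only
  generalize c k = v
  revert v
  decide

/-! ### The program -/

namespace XorCNF

open RAM

/-! Names of the arrays. An array whose name ends in `R` is used as a scalar variable only. The
array `inpA` holds the input; so its cell 0 is the number of clauses. -/

local notation "inpA" => (0 : ℕ)
local notation "varR" => (1 : ℕ)
local notation "posR" => (2 : ℕ)
local notation "numR" => (3 : ℕ)
local notation "clauseR" => (4 : ℕ)
local notation "entryR" => (5 : ℕ)
local notation "baseA" => (6 : ℕ)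
local notation "vecA" => (7 : ℕ)
local notation "lenR" => (8 : ℕ)
local notation "cellR" => (9 : ℕ)
local notation "rankR" => (10 : ℕ)
local notation "rowR" => (11 : ℕ)
local notation "pivotA" => (12 : ℕ)
local notation "startA" => (13 : ℕ)
local notation "powA" => (14 : ℕ)
local notation "basisA" => (15 : ℕ)
local notation "pivotR" => (16 : ℕ)
local notation "countR" => (17 : ℕ)
local notation "restR" => (18 : ℕ)
local notation "digitR" => (19 : ℕ)

/-- The absolute value of the difference. -/
def diff (e f : Expr) : Expr := .add (.sub e f) (.sub f e)

theorem eval_diff (e f : Expr) (M : Mem) :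
    (diff e f).eval M = (e.eval M - f.eval M) + (f.eval M - e.eval M) := rfl

/-- Scan the input: compute `base` and the column of the variable in `varR`. -/
def parse : Prog :=
  .seq (.assign posR (.lit 1)) <|
  .forLoop clauseR (.var inpA) <|
    .seq (.store baseA (.var clauseR) (.sub (.lit 1) (.cell inpA (.var posR)))) <|
    .seq (.store vecA (.var clauseR) (.lit 0)) <|
    .seq (.assign numR (.cell inpA (.add (.var posR) (.lit 1)))) <|
    .seq (.assign posR (.add (.var posR) (.lit 2))) <|
    .forLoop entryR (.var numR) <|
      .seq (.ite (diff (.cell inpA (.var posR)) (.var varR)) .skip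
        (.store vecA (.var clauseR) (.sub (.lit 1) (.cell vecA (.var clauseR))))) <|
      .assign posR (.add (.var posR) (.lit 1))

/-- Add the basis vector number `rowR` to the vector in `vecA`. -/
def addRow : Prog :=
  .forLoop entryR (.var inpA) <|
    .store vecA (.var entryR) (diff (.cell vecA (.var entryR))
      (.cell basisA (.add (.cell startA (.var rowR)) (.var entryR))))

/-- Make the vector in `vecA` vanish at all pivots by adding basis vectors. -/
def reduce : Prog :=
  .forLoop rowR (.var rankR) <|
    .ite (.cell vecA (.cell pivotA (.var rowR))) addRow .skip

/-- Find a nonzero entry of the vector in `vecA`. -/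
def findPivot : Prog :=
  .seq (.assign pivotR (.lit 0)) <|
  .forLoop entryR (.var inpA) <|
    .ite (.cell vecA (.var entryR)) (.assign pivotR (.add (.var entryR) (.lit 1))) .skip

/-- Append the vector in `vecA` to the basis, if it is not zero. -/
def extend : Prog :=
  .ite (.var pivotR)
    (.seq (.forLoop entryR (.var inpA) <|
      .store basisA (.add (.cell startA (.var rankR)) (.var entryR))
        (.cell vecA (.var entryR))) <|
    .seq (.store pivotA (.var rankR) (.sub (.var pivotR) (.lit 1))) <|
    .seq (.store startA (.add (.var rankR) (.lit 1))
      (.add (.cell startA (.var rankR)) (.var inpA))) <|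
    .seq (.store powA (.add (.var rankR) (.lit 1))
      (.add (.cell powA (.var rankR)) (.cell powA (.var rankR)))) <|
    .assign rankR (.add (.var rankR) (.lit 1)))
    .skip

/-- Compute a triangular basis of the span of the columns. -/
def prepare : Prog :=
  .seq parse <|
  .seq (.assign lenR (.var posR)) <|
  .seq (.store powA (.lit 0) (.lit 1)) <|
  .forLoop cellR (.var lenR) <|
    .seq (.assign varR (.cell inpA (.var cellR))) <|
    .seq parse <|
    .seq reduce <|
    .seq findPivot extend

/-- Compute the signature whose coefficients are the binary digits of `countR`. -/
def decode : Prog :=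
  .seq (.forLoop entryR (.var inpA) <|
    .store vecA (.var entryR) (.cell baseA (.var entryR))) <|
  .seq (.assign restR (.var countR)) <|
  .forLoop digitR (.var rankR) <|
    .seq (.assign rowR (.sub (.sub (.var rankR) (.lit 1)) (.var digitR))) <|
    .ite (.sub (.add (.var restR) (.lit 1)) (.cell powA (.var rowR)))
      (.seq (.assign restR (.sub (.var restR) (.cell powA (.var rowR)))) addRow)
      .skip

/-- Output one signature, and clear the variables that have been used. -/
def outputNext : Prog :=
  .seq decode <|
  .seq (.forLoop entryR (.var inpA) <| .write (.cell vecA (.var entryR))) <|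
  .seq .emit <|
  .seq (.assign countR (.add (.var countR) (.lit 1))) <|
  .seq (.assign entryR (.lit 0)) <|
  .seq (.assign rowR (.lit 0)) <|
  .seq (.assign restR (.lit 0)) <|
  .assign digitR (.lit 0)

/-- As long as not all combinations of the basis vectors have been output. -/
def guard : Expr := .sub (.cell powA (.var rankR)) (.var countR)

/-- The enumeration program. -/
def enumerate : Prog := .seq prepare (.loop guard outputNext)

/-! ### Correctness of the parts of the program -/

theorem val_add_eq (u v : ZMod 2) : (u + v).val = (u.val - v.val) + (v.val - u.val) := by
  revert u v
  decide

theorem val_eq_zero_or_one (u : ZMod 2) : u = 0 ∨ u = 1 := by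
  revert u
  decide

/-- The input is in place. -/
def HasInput (φ : XorCNF) (s : State) : Prop := ∀ i, s.mem (inpA, i) = φ.encode.getD i 0

theorem HasInput.frame {φ : XorCNF} {P : Prog} {s s' : State} (h : HasInput φ s)
    (hF : Frame P s s') (hP : inpA ∉ P.arrays) : HasInput φ s' :=
  fun i => (hF.mem _ hP i).trans (h i)

theorem HasInput.length {φ : XorCNF} {s : State} (h : HasInput φ s) :
    s.mem (inpA, 0) = φ.length := h 0

/-- The clause on indices from m on is needed for the space bound: the frame condition says nothing
about an array that is written at computed indices. -/
theorem addRow_spec {N m i : ℕ} {s : State} {u e : ℕ → ZMod 2} (hm : s.mem (inpA, 0) = m)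
    (hN : m ≤ N) (hi : s.mem (rowR, 0) = i) (hu : ∀ j < m, s.mem (vecA, j) = (u j).val)
    (he : ∀ j < m, s.mem (basisA, s.mem (startA, i) + j) = (e j).val) :
    WP N addRow (fun s' => (∀ j < m, s'.mem (vecA, j) = ((u + e) j).val) ∧
      ∀ j ≥ m, s'.mem (vecA, j) = s.mem (vecA, j)) s := by
  refine WP.forLoop (n := m) (fun k s' => ∀ j, s'.mem (vecA, j) =
    if j < k then ((u + e) j).val else s.mem (vecA, j)) hN (by decide) (by simp) ?_ ?_ ?_
  · intro s' hF
    simp [Expr.eval, hF.mem inpA (by decide), hm]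
  · intro k hk s' hF hI hk'
    refine WP.store fun j => ?_
    simp only [State.set_mem, Expr.eval, eval_diff, hk', hF.mem startA (by decide),
      hF.mem basisA (by decide), hF.mem rowR (by decide), hi, he k hk, hI]
    rcases lt_trichotomy j k with h | rfl | h
    · simp [h, h.ne, h.trans (Nat.lt_succ_self k)]
    · simp [hu j hk, val_add_eq]
    · simp [h.not_gt, h.ne', Nat.not_lt.2 (Nat.succ_le_of_lt h)]
  · intro s' _ hI
    exact ⟨fun j hj => by simp [hI, hj], fun j hj => by simp [hI, Nat.not_lt.2 hj]⟩

/-- The column is found by flipping its entry at every occurrence of x, which counts occurrences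
modulo 2. The reading position ends at the length of the input. -/
theorem parse_spec {N x : ℕ} {φ : XorCNF} {s : State} (h : HasInput φ s)
    (hN : φ.encode.length ≤ N) (hx : s.mem (varR, 0) = x) :
    WP N parse (fun s' => s'.mem (posR, 0) = φ.encode.length ∧
      (∀ j < φ.length, s'.mem (baseA, j) = (φ.base j).val) ∧
      ∀ j < φ.length, s'.mem (vecA, j) = (φ.column x j).val) s := by
  refine WP.seq (WP.assign (WP.forLoop (n := φ.length)
    (fun c s' => s'.mem (posR, 0) = φ.offset c ∧
      (∀ j < c, s'.mem (baseA, j) = (φ.base j).val) ∧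
      ∀ j < c, s'.mem (vecA, j) = (φ.column x j).val)
    (φ.length_le_length_encode.trans hN) (by decide) (by simp [Expr.eval]) ?_ ?_ ?_))
  · intro s' hF
    simp [Expr.eval, hF.mem inpA (by decide), h.length]
  · rintro c hc s' hF ⟨hpos, hbase, hvec⟩ hc'
    have hx' : s'.mem (varR, 0) = x := by simpa [hx] using hF.mem varR (by decide) 0
    have h' : HasInput φ s' := fun i => by simpa [h i] using hF.mem inpA (by decide) i
    refine WP.seq (WP.store (WP.seq (WP.store (WP.seq (WP.assign (WP.seq (WP.assign
      (WP.forLoop (n := (φ.varsAt c).length)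
      (fun k s'' => s''.mem (posR, 0) = φ.offset c + 2 + k ∧
        (∀ j < c, s''.mem (vecA, j) = (φ.column x j).val) ∧
        s''.mem (vecA, c) = (((φ.varsAt c).take k).count x : ZMod 2).val)
      ((φ.length_varsAt_le hc).trans hN) (by decide) ?_ ?_ ?_ ?_))))))))
    · simp only [State.set_mem, Expr.eval, hc', hpos]
      simp +contextual [Nat.ne_of_lt, hvec]
    · intro s'' hF'
      simp only [Expr.eval, hF'.mem numR (by decide)]
      simp only [State.set_mem, hpos]
      simp only [Nat.reduceEqDiff, false_and, and_self, if_true, if_false, h' _,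
        encode_getD_length φ hc]
    · rintro k hk s'' hF' ⟨hpos', hvec', hvecc⟩ -
      have hx'' : s''.mem (varR, 0) = x := by
        rw [hF'.mem varR (by decide)]
        simp [hx']
      have hc'' : s''.mem (clauseR, 0) = c := by
        rw [hF'.mem clauseR (by decide)]
        simp [hc']
      have hin : s''.mem (inpA, φ.offset c + 2 + k) = (φ.varsAt c)[k] := by
        rw [hF'.mem inpA (by decide), ← encode_getD_var φ hc hk, ← h']
        simp
      have hcount : (((φ.varsAt c).take (k + 1)).count x : ZMod 2) =
          (((φ.varsAt c).take k).count x : ZMod 2) + if (φ.varsAt c)[k] = x then 1 else 0 := by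
        rw [List.take_succ_eq_append_getElem hk, List.count_append, List.count_singleton]
        by_cases hxk : (φ.varsAt c)[k] = x <;> simp [hxk]
      refine WP.seq (WP.ite (fun he => WP.skip (WP.assign ?_)) fun he =>
        WP.store (WP.assign ?_))
      · have : (φ.varsAt c)[k] ≠ x := by
          rintro hxk
          simp [eval_diff, Expr.eval, hpos', hin, hx'', hxk] at he
        refine ⟨by simp [Expr.eval, hpos', add_assoc], fun j hj => ?_, ?_⟩
        · simp [hvec' j hj]
        · simp [hvecc, hcount, this]
      · have : (φ.varsAt c)[k] = x := by
          simp only [eval_diff, Expr.eval, hpos', hin, hx''] at he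
          omega
        refine ⟨by simp [Expr.eval, hpos', add_assoc], fun j hj => ?_, ?_⟩
        · simp [Expr.eval, hc'', hvec' j hj, hj.ne]
        · simp only [State.set_mem, Expr.eval, hc'', hvecc, hcount, this]
          generalize (((φ.varsAt c).take k).count x : ZMod 2) = v
          simp only [Nat.reduceEqDiff, false_and, and_self, if_true, if_false]
          revert v
          decide
    · rintro s'' hF' ⟨hpos', hvec', hvecc⟩
      refine ⟨by simpa [offset_succ φ hc] using hpos', fun j hj => ?_, fun j hj => ?_⟩
      · simp only [State.set_mem, hF'.mem baseA (by decide), Expr.eval, hc', hpos, h' _,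
          encode_getD_rhs φ hc]
        rcases Nat.lt_succ_iff_lt_or_eq.1 hj with hj | rfl
        · simp [hj.ne, hbase j hj]
        · simp
      · rcases Nat.lt_succ_iff_lt_or_eq.1 hj with hj | rfl
        · simp [hvec' j hj]
        · simpa [column] using hvecc
  · rintro s' _ ⟨hpos, hvec⟩
    exact ⟨hpos.trans φ.offset_length, hvec⟩

/-- The memory contains the basis vectors `e 0, …, e (r - 1)` with the pivots `p`. -/
structure HasBasis (m r : ℕ) (e : ℕ → ℕ → ZMod 2) (p : ℕ → ℕ) (s : State) : Prop where
  rank : s.mem (rankR, 0) = r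
  pivot : ∀ i < r, s.mem (pivotA, i) = p i
  start : ∀ i ≤ r, s.mem (startA, i) = i * m
  pow : ∀ i ≤ r, s.mem (powA, i) = 2 ^ i
  vec : ∀ i < r, ∀ j < m, s.mem (basisA, i * m + j) = (e i j).val

theorem HasBasis.frame {m r : ℕ} {e : ℕ → ℕ → ZMod 2} {p : ℕ → ℕ} {P : Prog} {s s' : State}
    (h : HasBasis m r e p s) (hF : Frame P s s')
    (hP : ∀ a ∈ [rankR, pivotA, startA, powA, basisA], a ∉ P.arrays) : HasBasis m r e p s' := by
  simp only [List.forall_mem_cons, List.not_mem_nil, false_imp_iff, implies_true, and_true] at hP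
  obtain ⟨h₁, h₂, h₃, h₄, h₅⟩ := hP
  refine ⟨?_, ?_, ?_, ?_, ?_⟩
  · rw [hF.mem _ h₁, h.rank]
  · intro i hi
    rw [hF.mem _ h₂, h.pivot i hi]
  · intro i hi
    rw [hF.mem _ h₃, h.start i hi]
  · intro i hi
    rw [hF.mem _ h₄, h.pow i hi]
  · intro i hi j hj
    rw [hF.mem _ h₅, h.vec i hi j hj]

/-- The pivots are treated in increasing order. Adding `e k` cancels the entry at `p k`, as 1 + 1 =
0, and does not disturb the earlier pivots, where `e k` vanishes. -/
theorem reduce_spec {N m r : ℕ} {e : ℕ → ℕ → ZMod 2} {p : ℕ → ℕ} {u : ℕ → ZMod 2} {s : State}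
    (hm : s.mem (inpA, 0) = m) (hN : m ≤ N) (hr : r ≤ N) (hb : HasBasis m r e p s)
    (ht : Triangular m r e p) (hu : ∀ j < m, s.mem (vecA, j) = (u j).val) :
    WP N reduce (fun s' => ∃ u', (∀ j < m, s'.mem (vecA, j) = (u' j).val) ∧
      u' - u ∈ Submodule.span (ZMod 2) (e '' Set.Iio r) ∧ ∀ i < r, u' (p i) = 0) s := by
  refine WP.forLoop (n := r) (fun k s' => ∃ u', (∀ j < m, s'.mem (vecA, j) = (u' j).val) ∧
      u' - u ∈ Submodule.span (ZMod 2) (e '' Set.Iio r) ∧ ∀ i < k, u' (p i) = 0)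
    hr (by decide) ⟨u, by simpa using hu, by simp, by simp⟩ ?_ ?_ ?_
  · intro s' hF
    simp [Expr.eval, hF.mem rankR (by decide), hb.rank]
  · rintro k hk s' hF ⟨u', hu', hspan, hpiv⟩ hk'
    have hb' := hb.frame hF (by decide)
    have hm' := (hF.mem inpA (by decide) 0).trans hm
    have hval : (Expr.cell vecA (.cell pivotA (.var rowR))).eval s'.mem = (u' (p k)).val := by
      simp [Expr.eval, hk', hb'.pivot k hk, hu' _ (ht.lt k hk)]
    refine WP.ite (fun hne => ?_) fun heq => WP.skip ⟨u', ?_, hspan, fun i hi => ?_⟩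
    · refine (addRow_spec hm' hN hk' hu' (e := e k) fun j hj => ?_).mono
        fun s'' hF' ⟨hvec, _⟩ => ⟨u' + e k, ?_, ?_, fun i hi => ?_⟩
      · rw [hb'.start k hk.le, hb'.vec k hk j hj]
      · intro j hj
        simp [hvec j hj]
      · rw [add_sub_right_comm]
        exact Submodule.add_mem _ hspan (Submodule.subset_span ⟨k, hk, rfl⟩)
      · rw [Pi.add_apply]
        rcases Nat.lt_succ_iff_lt_or_eq.1 hi with hi | rfl
        · rw [hpiv i hi, ht.upper i k hi hk, add_zero]
        · rw [ht.diag i hk]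
          rcases val_eq_zero_or_one (u' (p i)) with h | h
          · simp [hval, h] at hne
          · rw [h]
            decide
    · intro j hj
      simp [hu' j hj]
    · rcases Nat.lt_succ_iff_lt_or_eq.1 hi with hi | rfl
      · exact hpiv i hi
      · exact (ZMod.val_eq_zero _).1 (hval.symm.trans heq)
  · exact fun s' _ h => h

/-- The stored pivot is shifted by one, so that 0 can mean that the vector has no nonzero entry. -/
theorem findPivot_spec {N m : ℕ} {u : ℕ → ZMod 2} {s : State} (hm : s.mem (inpA, 0) = m)
    (hN : m ≤ N) (hu : ∀ j < m, s.mem (vecA, j) = (u j).val) :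
    WP N findPivot (fun s' => (s'.mem (pivotR, 0) = 0 ∧ ∀ j < m, u j = 0) ∨
      ∃ q < m, s'.mem (pivotR, 0) = q + 1 ∧ u q = 1) s := by
  refine WP.seq (WP.assign (WP.forLoop (n := m)
    (fun k s' => (s'.mem (pivotR, 0) = 0 ∧ ∀ j < k, u j = 0) ∨
      ∃ q < m, s'.mem (pivotR, 0) = q + 1 ∧ u q = 1)
    hN (by decide) (.inl (by simp [Expr.eval])) ?_ ?_ ?_))
  · intro s' hF
    simp [Expr.eval, hF.mem inpA (by decide), hm]
  · intro k hk s' hF hI hk'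
    have hval : (Expr.cell vecA (.var entryR)).eval s'.mem = (u k).val := by
      simp [Expr.eval, hF.mem vecA (by decide), hk', hu k hk]
    refine WP.ite (fun hne => WP.assign (.inr ⟨k, hk, ?_, ?_⟩)) fun heq => WP.skip ?_
    · simp [Expr.eval, hk']
    · rcases val_eq_zero_or_one (u k) with h | h
      · simp [hval, h] at hne
      · exact h
    · have h0 := (ZMod.val_eq_zero _).1 (hval.symm.trans heq)
      refine hI.imp (fun ⟨h₁, h₂⟩ => ⟨by simpa using h₁, fun j hj => ?_⟩) fun ⟨q, h⟩ =>
        ⟨q, by simpa using h⟩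
      rcases Nat.lt_succ_iff_lt_or_eq.1 hj with hj | rfl
      exacts [h₂ j hj, h0]
  · exact fun s' _ h => h

/-- The machine sees only the entries below m. The hypothesis that u vanishes from m on makes its
zero test decide u = 0, which is what the equality of spans needs when no vector is appended. -/
theorem extend_spec {N m r : ℕ} {e : ℕ → ℕ → ZMod 2} {p : ℕ → ℕ} {u : ℕ → ZMod 2} {s : State}
    (hm : s.mem (inpA, 0) = m) (hN : m ≤ N) (hb : HasBasis m r e p s) (ht : Triangular m r e p)
    (hu : ∀ j < m, s.mem (vecA, j) = (u j).val) (hu' : ∀ j ≥ m, u j = 0)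
    (hp : ∀ i < r, u (p i) = 0)
    (hq : (s.mem (pivotR, 0) = 0 ∧ ∀ j < m, u j = 0) ∨
      ∃ q < m, s.mem (pivotR, 0) = q + 1 ∧ u q = 1) :
    WP N extend (fun s' => ∃ r₁ ≤ r + 1, ∃ e₁ p₁, HasBasis m r₁ e₁ p₁ s' ∧
      Triangular m r₁ e₁ p₁ ∧ Submodule.span (ZMod 2) (e₁ '' Set.Iio r₁) =
        Submodule.span (ZMod 2) {u} ⊔ Submodule.span (ZMod 2) (e '' Set.Iio r)) s := by
  rcases hq with ⟨hq, hu₀⟩ | ⟨q, hqm, hq, huq⟩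
  · refine WP.ite (fun h => absurd (by simpa [Expr.eval] using hq) h) fun _ => WP.skip
      ⟨r, by omega, e, p, hb, ht, ?_⟩
    obtain rfl : u = 0 := funext fun j => (lt_or_ge j m).elim (hu₀ j) (hu' j)
    simp
  · refine WP.ite (fun _ => ?_) fun h => absurd h (by simp [Expr.eval, hq])
    refine WP.seq (WP.forLoop (n := m) (fun k s' => (∀ i < r, ∀ j < m,
        s'.mem (basisA, i * m + j) = (e i j).val) ∧
        ∀ j < k, s'.mem (basisA, r * m + j) = (u j).val)
      hN (by decide) ⟨by simpa using hb.vec, by simp⟩ ?_ ?_ ?_)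
    · intro s' hF
      simp [Expr.eval, hF.mem inpA (by decide), hm]
    · rintro k hk s' hF ⟨h₁, h₂⟩ hk'
      have hstart : s'.mem (startA, r) = r * m := by
        rw [hF.mem startA (by decide), hb.start r le_rfl]
      have hrank : s'.mem (rankR, 0) = r := by
        rw [hF.mem rankR (by decide), hb.rank]
      have hvec : s'.mem (vecA, k) = (u k).val := by
        rw [hF.mem vecA (by decide), hu k hk]
      refine WP.store ⟨fun i hi j hj => ?_, fun j hj => ?_⟩
      · have : i * m + j ≠ r * m + k := by
          have : (i + 1) * m ≤ r * m := Nat.mul_le_mul_right m hi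
          rw [Nat.succ_mul] at this
          omega
        simp [Expr.eval, hk', hrank, hstart, this, h₁ i hi j hj]
      · rcases Nat.lt_succ_iff_lt_or_eq.1 hj with hj | rfl
        · simp [Expr.eval, hk', hrank, hstart, hj.ne, h₂ j hj]
        · simp [Expr.eval, hk', hrank, hstart, hvec]
    · rintro s' hF ⟨h₁, h₂⟩
      have hrank : s'.mem (rankR, 0) = r := by
        rw [hF.mem rankR (by decide), hb.rank]
      have hm' : s'.mem (inpA, 0) = m := by
        rw [hF.mem inpA (by decide), hm]
      have hq' : s'.mem (pivotR, 0) = q + 1 := by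
        rw [hF.mem pivotR (by decide), hq]
      have hstart : ∀ i ≤ r, s'.mem (startA, i) = i * m := fun i hi => by
        rw [hF.mem startA (by decide), hb.start i hi]
      have hpow : ∀ i ≤ r, s'.mem (powA, i) = 2 ^ i := fun i hi => by
        rw [hF.mem powA (by decide), hb.pow i hi]
      have hpivot : ∀ i < r, s'.mem (pivotA, i) = p i := fun i hi => by
        rw [hF.mem pivotA (by decide), hb.pivot i hi]
      refine WP.seq (WP.store (WP.seq (WP.store (WP.seq (WP.store (WP.assign
        ⟨r + 1, le_rfl, Function.update e r u, Function.update p r q, ⟨?_, fun i hi => ?_,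
          fun i hi => ?_, fun i hi => ?_, fun i hi j hj => ?_⟩, ht.snoc hqm huq hp, ?_⟩))))))
      · simp [Expr.eval, hrank]
      · rcases Nat.lt_succ_iff_lt_or_eq.1 hi with hi | rfl
        · simp [Expr.eval, hrank, hi.ne, hpivot i hi]
        · simp [Expr.eval, hrank, hq']
      · rcases Nat.le_succ_iff.1 hi with hi | rfl
        · simp [Expr.eval, hrank, (Nat.lt_succ_of_le hi).ne, hstart i hi]
        · simp [Expr.eval, hrank, hm', hstart r le_rfl, Nat.succ_mul]
      · rcases Nat.le_succ_iff.1 hi with hi | rfl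
        · simp [Expr.eval, hrank, (Nat.lt_succ_of_le hi).ne, hpow i hi]
        · simp [Expr.eval, hrank, hpow r le_rfl, pow_succ, mul_two]
      · rcases Nat.lt_succ_iff_lt_or_eq.1 hi with hi | rfl
        · simp [hi.ne, h₁ i hi j hj]
        · simp [h₂ j hj]
      · rw [← Submodule.span_union, Set.singleton_union]
        congr 1
        ext v
        simp only [Set.mem_image, Set.mem_Iio, Set.mem_insert_iff]
        constructor
        · rintro ⟨i, hi, rfl⟩
          rcases Nat.lt_succ_iff_lt_or_eq.1 hi with hi | rfl
          · exact .inr ⟨i, hi, by simp [hi.ne]⟩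
          · simp
        · rintro (rfl | ⟨i, hi, rfl⟩)
          · exact ⟨r, Nat.lt_succ_self r, by simp⟩
          · exact ⟨i, hi.trans (Nat.lt_succ_self r), by simp [hi.ne]⟩

theorem column_eq_zero (φ : XorCNF) (x : ℕ) {c : ℕ} (hc : φ.length ≤ c) : φ.column x c = 0 := by
  simp [column, varsAt, List.getElem?_eq_none hc]

theorem eq_zero_of_mem_span_column {φ : XorCNF} {S : Set ℕ} {u : ℕ → ZMod 2}
    (hu : u ∈ Submodule.span (ZMod 2) (φ.column '' S)) {c : ℕ} (hc : φ.length ≤ c) : u c = 0 := by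
  have : Submodule.span (ZMod 2) (φ.column '' S) ≤ LinearMap.ker (LinearMap.proj c) := by
    rw [Submodule.span_le]
    rintro _ ⟨x, -, rfl⟩
    exact φ.column_eq_zero x hc
  exact this hu

/-- Invariant: after k numbers of the input have been treated, the basis spans their columns. The
empty basis needs only 2^0 to be stored, because rank and first row position are 0 in the fresh
memory. -/
theorem prepare_spec {N : ℕ} {φ : XorCNF} {s : State} (h : HasInput φ s)
    (hN : φ.encode.length ≤ N) (hs : ∀ a ≠ inpA, ∀ i, s.mem (a, i) = 0) :
    WP N prepare (fun s' => ∃ r ≤ N, ∃ e p, HasBasis φ.length r e p s' ∧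
      Triangular φ.length r e p ∧
      Submodule.span (ZMod 2) (e '' Set.Iio r) =
        Submodule.span (ZMod 2) (φ.column '' {x | x ∈ φ.encode}) ∧
      ∀ j < φ.length, s'.mem (baseA, j) = (φ.base j).val) s := by
  -- The machine is not told the length of its input; the first pass of `parse` measures it, and its
  -- column is not used.
  have hmN := φ.length_le_length_encode.trans hN
  refine WP.seq ((parse_spec h hN rfl).mono fun s₁ hF₁ ⟨hpos, hbase, _⟩ =>
    WP.seq (WP.assign (WP.seq (WP.store (WP.forLoop (n := φ.encode.length)
      (fun k s' => (∃ r ≤ k, ∃ e p, HasBasis φ.length r e p s' ∧ Triangular φ.length r e p ∧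
        Submodule.span (ZMod 2) (e '' Set.Iio r) =
          Submodule.span (ZMod 2) (φ.column '' {x | x ∈ φ.encode.take k})) ∧
        ∀ j < φ.length, s'.mem (baseA, j) = (φ.base j).val)
      hN (by decide) ⟨⟨0, le_rfl, 0, 0, ⟨?_, ?_, ?_, ?_, ?_⟩, ⟨?_, ?_, ?_⟩, ?_⟩, ?_⟩
      ?_ ?_ ?_)))))
  · simp [hF₁.mem rankR (by decide), hs]
  · simp
  · simp [hF₁.mem startA (by decide), hs]
  · simp [Expr.eval]
  · simp
  · simp
  · simp
  · simp
  · simp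
  · simpa using hbase
  · intro s' hF
    simp only [Expr.eval, hF.mem lenR (by decide)]
    simp [hpos]
  · rintro k hk s' hF ⟨⟨r, hr, e, p, hb, ht, hspan⟩, hbase'⟩ hk'
    have h₁ : HasInput φ s₁ := h.frame hF₁ (by decide)
    have h' : HasInput φ s' := fun i => by
      rw [hF.mem inpA (by decide), ← h₁]
      simp
    have hrN : r ≤ N := by omega
    refine WP.seq (WP.assign (WP.seq ((parse_spec (x := φ.encode[k]) (fun i => ?_) hN ?_).mono
      fun s₂ hF₂ ⟨_, hbase₂, hvec₂⟩ => WP.seq ?_)))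
    · simp [h' i]
    · simp [Expr.eval, hk', h' k, hk]
    have hi₂ : HasInput φ s₂ := fun i => by
      rw [hF₂.mem inpA (by decide), ← h' i]
      simp
    have hb₁ : HasBasis φ.length r e p
        (s'.set varR 0 ((Expr.cell inpA (.var cellR)).eval s'.mem)) :=
      ⟨by simp [hb.rank], by simpa using hb.pivot, by simpa using hb.start,
        by simpa using hb.pow, by simpa using hb.vec⟩
    have hb₂ := hb₁.frame hF₂ (by decide)
    refine (reduce_spec hi₂.length hmN hrN hb₂ ht hvec₂).mono
      fun s₃ hF₃ ⟨u, hu, hsub, hpiv⟩ => WP.seq ?_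
    have hi₃ := hi₂.frame hF₃ (by decide)
    have hb₃ := hb₂.frame hF₃ (by decide)
    refine (findPivot_spec hi₃.length hmN hu).mono fun s₄ hF₄ hq => ?_
    have hi₄ := hi₃.frame hF₄ (by decide)
    have hb₄ := hb₃.frame hF₄ (by decide)
    have hset : φ.column '' {x | x ∈ φ.encode.take (k + 1)} =
        insert (φ.column φ.encode[k]) (φ.column '' {x | x ∈ φ.encode.take k}) := by
      rw [← Set.image_insert_eq]
      congr 1
      ext x
      rw [List.take_succ_eq_append_getElem hk]
      simp only [Set.mem_ofPred_eq, List.mem_append, List.mem_singleton, Set.mem_insert_iff,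
        or_comm]
    have hmem : u ∈ Submodule.span (ZMod 2) (φ.column '' {x | x ∈ φ.encode.take (k + 1)}) := by
      rw [hset, ← sub_add_cancel u (φ.column φ.encode[k])]
      rw [hspan] at hsub
      exact Submodule.add_mem _ (Submodule.span_mono (Set.subset_insert _ _) hsub)
        (Submodule.subset_span (Set.mem_insert _ _))
    refine (extend_spec hi₄.length hmN hb₄ ht (fun j hj => ?_)
      (fun j hj => eq_zero_of_mem_span_column hmem hj) hpiv hq).mono
      fun s₅ hF₅ ⟨r', hr', e', p', hb', ht', hspan'⟩ =>
        ⟨⟨r', by omega, e', p', ⟨?_, ?_, ?_, ?_, ?_⟩, ht', ?_⟩, fun j hj => ?_⟩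
    · rw [hF₄.mem vecA (by decide), hu j hj]
    · simp [hb'.rank]
    · simpa using hb'.pivot
    · simpa using hb'.start
    · simpa using hb'.pow
    · simpa using hb'.vec
    -- Exchange: the reduced vector u and the new column differ by an element of the old span, so
    -- either of them extends that span to the same space.
    · rw [hspan', hspan, hset, Submodule.span_insert]
      rw [hspan] at hsub
      apply le_antisymm
      · refine sup_le ?_ le_sup_right
        rw [Submodule.span_singleton_le_iff_mem, ← Submodule.span_insert, ← hset]
        exact hmem
      · refine sup_le ?_ le_sup_right
        rw [Submodule.span_singleton_le_iff_mem, ← sub_sub_self u (φ.column φ.encode[k])]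
        exact Submodule.sub_mem _ (Submodule.mem_sup_left (Submodule.mem_span_singleton_self u))
          (Submodule.mem_sup_right hsub)
    · simp [hF₅.mem baseA (by decide), hF₄.mem baseA (by decide), hF₃.mem baseA (by decide),
        hbase₂ j hj]
  · rintro s' _ ⟨⟨r, hr, e, p, hb, ht, hspan⟩, hbase'⟩
    rw [List.take_length] at hspan
    exact ⟨r, hr.trans hN, e, p, hb, ht, hspan, hbase'⟩

/-- After the digits from l up have been treated, the remainder is K modulo 2^l and the vector is
`base` plus `digitSum e K l r`. Going downwards lets comparison and subtraction with the stored
powers replace division. -/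
theorem decode_spec {N r K : ℕ} {φ : XorCNF} {e : ℕ → ℕ → ZMod 2} {p : ℕ → ℕ} {s : State}
    (h : HasInput φ s) (hN : φ.length ≤ N) (hr : r ≤ N) (hb : HasBasis φ.length r e p s)
    (hbase : ∀ j < φ.length, s.mem (baseA, j) = (φ.base j).val) (hK : K < 2 ^ r)
    (hcount : s.mem (countR, 0) = K) :
    WP N decode (fun s' =>
      (∀ j < φ.length, s'.mem (vecA, j) = ((φ.base + digitSum e K 0 r) j).val) ∧
      ∀ j ≥ φ.length, s'.mem (vecA, j) = s.mem (vecA, j)) s := by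
  refine WP.seq (WP.forLoop (n := φ.length)
    (fun k s' => ∀ j, s'.mem (vecA, j) = if j < k then (φ.base j).val else s.mem (vecA, j))
    hN (by decide) (by simp) ?_ ?_ ?_)
  · intro s' hF
    simp [Expr.eval, hF.mem inpA (by decide), h.length]
  · intro k hk s' hF hI hk'
    refine WP.store fun j => ?_
    simp only [State.set_mem, Expr.eval, hk', hF.mem baseA (by decide), hbase k hk, hI]
    rcases lt_trichotomy j k with h | rfl | h
    · simp [h, h.ne, h.trans (Nat.lt_succ_self k)]
    · simp
    · simp [h.not_gt, h.ne', Nat.not_lt.2 (Nat.succ_le_of_lt h)]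
  · intro s₁ hF₁ hI
    have h₁ := h.frame hF₁ (by decide)
    have hb₁ := hb.frame hF₁ (by decide)
    have hcount₁ : s₁.mem (countR, 0) = K := by
      rw [hF₁.mem countR (by decide), hcount]
    refine WP.seq (WP.assign (WP.forLoop (n := r)
      (fun k s' => s'.mem (restR, 0) = K % 2 ^ (r - k) ∧
        (∀ j < φ.length, s'.mem (vecA, j) = ((φ.base + digitSum e K (r - k) r) j).val) ∧
        ∀ j ≥ φ.length, s'.mem (vecA, j) = s.mem (vecA, j))
      hr (by decide) ⟨?_, fun j hj => ?_, fun j hj => ?_⟩ ?_ ?_ ?_))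
    · simp [Expr.eval, hcount₁, Nat.mod_eq_of_lt hK]
    · simp [hI, hj, digitSum_self]
    · simp [hI, Nat.not_lt.2 hj]
    · intro s' hF
      simp only [Expr.eval, hF.mem rankR (by decide)]
      simp [hb₁.rank]
    · rintro k hk s' hF ⟨hrest, hvec, hvec'⟩ hk'
      obtain ⟨i, hi, hi₁, hi₂, hir⟩ :
          ∃ i, r - 1 - k = i ∧ r - k = i + 1 ∧ r - (k + 1) = i ∧ i < r :=
        ⟨r - 1 - k, rfl, by omega, by omega, by omega⟩
      rw [hi₁] at hrest hvec
      rw [hi₂]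
      have hb₂ : HasBasis φ.length r e p s' := by
        refine ⟨?_, fun j hj => ?_, fun j hj => ?_, fun j hj => ?_, fun j hj l hl => ?_⟩
        · simpa [hb₁.rank] using hF.mem rankR (by decide) 0
        · simpa [hb₁.pivot j hj] using hF.mem pivotA (by decide) j
        · simpa [hb₁.start j hj] using hF.mem startA (by decide) j
        · simpa [hb₁.pow j hj] using hF.mem powA (by decide) j
        · simpa [hb₁.vec j hj l hl] using hF.mem basisA (by decide) (j * φ.length + l)
      have hm' : s'.mem (inpA, 0) = φ.length := by
        simpa [h₁.length] using hF.mem inpA (by decide) 0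
      have hrow : (Expr.sub (.sub (.var rankR) (.lit 1)) (.var digitR)).eval s'.mem = i := by
        simp [Expr.eval, hb₂.rank, hk', hi]
      have hmod : K % 2 ^ (i + 1) = K % 2 ^ i + 2 ^ i * (K.testBit i).toNat := by
        rw [Nat.mod_pow_succ, Nat.toNat_testBit]
      have hlt : K % 2 ^ i < 2 ^ i := Nat.mod_lt _ (by positivity)
      have hpow := hb₂.pow i hir.le
      refine WP.seq (WP.assign ?_)
      rw [hrow]
      -- The guard is nonzero iff 2^i is at most the remainder. As the remainder is K modulo 2^(i +
      -- 1), this says that digit i of K is 1.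
      refine WP.ite (fun hne => WP.seq (WP.assign ?_)) fun heq => WP.skip ?_
      · have hbit : K.testBit i = true := by
          by_contra hbit
          simp only [Bool.not_eq_true] at hbit
          simp [Expr.eval, hrest, hpow, hmod, hbit] at hne
          omega
        refine (addRow_spec (m := φ.length) (i := i)
          (u := φ.base + digitSum e K (i + 1) r) (e := e i) ?_ hN ?_ ?_ ?_).mono
          fun s'' hF' ⟨hv, hv'⟩ => ⟨?_, fun j hj => ?_, fun j hj => ?_⟩
        · simp [hm']
        · simp
        · simpa using hvec
        · intro j hj
          simp [hb₂.start i hir.le, hb₂.vec i hir j hj]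
        · simp only [State.set_mem, hF'.mem restR (by decide), Expr.eval]
          simp [hrest, hpow, hmod, hbit]
        · rw [digitSum_eq_add e K hir, hbit, ← add_assoc]
          simpa using hv j hj
        · simpa [hvec' j hj] using hv' j hj
      · have hbit : K.testBit i = false := by
          by_contra hbit
          simp only [Bool.not_eq_false] at hbit
          simp [Expr.eval, hrest, hpow, hmod, hbit] at heq
          omega
        refine ⟨?_, fun j hj => ?_, fun j hj => ?_⟩
        · simp [hrest, hmod, hbit]
        · rw [digitSum_eq_add e K hir, hbit]
          simpa using hvec j hj
        · simp [hvec' j hj]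
    · rintro s' _ ⟨_, hv⟩
      simpa using hv

/-! ### The enumeration -/

/-- The signature whose coefficients are the binary digits of `K`. -/
def nthSignature (φ : XorCNF) (e : ℕ → ℕ → ZMod 2) (r K : ℕ) : List Bool :=
  bits φ.length (φ.base + digitSum e K 0 r)

/-- The state after `K` signatures have been output. The memory differs from `M` only in few
cells with small contents. -/
structure Enumerated (φ : XorCNF) (N r : ℕ) (e : ℕ → ℕ → ZMod 2) (p : ℕ → ℕ) (M : Mem) (K : ℕ)
    (s : State) : Prop where
  input : HasInput φ s
  basis : HasBasis φ.length r e p s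
  base : ∀ j < φ.length, s.mem (baseA, j) = (φ.base j).val
  count : s.mem (countR, 0) = K
  buf : s.buf = []
  out : s.out = (List.range K).map (φ.nthSignature e r)
  near : ∀ a i, s.mem (a, i) = M (a, i) ∨ a < 20 ∧ i ≤ N ∧ s.mem (a, i) ≤ 2 ^ N

/-- Clearing the scratch variables at the end makes their smallness immediate in `near`; the other
changes are to the counter, at most 2^N, and to entries of the work vector, at most 1. -/
theorem outputNext_spec {φ : XorCNF} {N r K : ℕ} {e : ℕ → ℕ → ZMod 2} {p : ℕ → ℕ} {M : Mem}
    {s : State} (hN : φ.length ≤ N) (hr : r ≤ N) (hK : K < 2 ^ r)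
    (h : Enumerated φ N r e p M K s) :
    WP N outputNext (Enumerated φ N r e p M (K + 1)) s := by
  refine WP.mono (Q := fun s' => s'.mem (countR, 0) = K + 1 ∧ s'.buf = [] ∧
    s'.out = (List.range (K + 1)).map (φ.nthSignature e r) ∧
    (∀ j < φ.length, s'.mem (vecA, j) ≤ 1) ∧
    (∀ j ≥ φ.length, s'.mem (vecA, j) = s.mem (vecA, j)) ∧
    s'.mem (entryR, 0) = 0 ∧ s'.mem (rowR, 0) = 0 ∧ s'.mem (restR, 0) = 0 ∧
    s'.mem (digitR, 0) = 0) ?_ ?_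
  · refine WP.seq ((decode_spec h.input hN hr h.basis h.base hK h.count).mono
      fun s₁ hF₁ ⟨hvec, hvec'⟩ => WP.seq (WP.forLoop (n := φ.length)
        (fun k s' => s'.buf = bits k (φ.base + digitSum e K 0 r) ∧ s'.out = s₁.out)
        hN (by decide) ?_ ?_ ?_ ?_))
    · simp [hF₁.buf (by decide), h.buf, bits]
    · intro s' hF
      simp [Expr.eval, hF.mem inpA (by decide), (h.input.frame hF₁ (by decide)).length]
    · rintro k hk s' hF ⟨hI, ho⟩ hk'
      refine WP.write ⟨?_, ho⟩
      simp only [State.set_buf, hI, Expr.eval, hk', hF.mem vecA (by decide), hvec k hk, bits,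
        List.range_succ, List.map_append, List.map_singleton, ne_eq, ZMod.val_eq_zero]
    · rintro s₂ hF₂ ⟨hbuf, ho⟩
      have hcount : s₂.mem (countR, 0) = K := by
        rw [hF₂.mem countR (by decide), hF₁.mem countR (by decide), h.count]
      have hout : s₂.out = (List.range K).map (φ.nthSignature e r) := by
        rw [ho, hF₁.out (by decide), h.out]
      refine WP.seq (WP.emit (WP.seq (WP.assign (WP.seq (WP.assign (WP.seq (WP.assign
        (WP.seq (WP.assign (WP.assign ⟨?_, ?_, ?_, fun j hj => ?_, fun j hj => ?_, ?_⟩))))))))))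
      · simp [Expr.eval, hcount]
      · simp
      · simp [hout, hbuf, List.range_succ, nthSignature]
      · have := ZMod.val_lt ((φ.base + digitSum e K 0 r) j)
        simp only [State.set_mem, hF₂.mem vecA (by decide), hvec j hj]
        simp only [Nat.reduceEqDiff, false_and, if_false]
        omega
      · simp [hF₂.mem vecA (by decide), hvec' j hj]
      · simp [Expr.eval]
  · rintro s' hF ⟨hcount, hbuf, hout, hvec, hvec', h₁, h₂, h₃, h₄⟩
    refine ⟨h.input.frame hF (by decide), h.basis.frame hF (by decide), fun j hj => ?_, hcount,
      hbuf, hout, fun a i => ?_⟩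
    · rw [hF.mem baseA (by decide), h.base j hj]
    have hKN : K + 1 ≤ 2 ^ N :=
      (Nat.succ_le_of_lt hK).trans (Nat.pow_le_pow_right two_pos hr)
    -- The changed cells are five scalars and the first entries of the work vector. All others are
    -- fixed by the frame, where `scalar` handles the nonzero indices of arrays used as scalars.
    by_cases hi : i = 0 ∧ (a = countR ∨ a = entryR ∨ a = rowR ∨ a = restR ∨ a = digitR)
    · right
      obtain ⟨rfl, rfl | rfl | rfl | rfl | rfl⟩ := hi <;> simp [*]
    by_cases hv : a = vecA ∧ i < φ.length
    · obtain ⟨rfl, hv⟩ := hv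
      exact .inr ⟨by norm_num, by omega, (hvec i hv).trans Nat.one_le_two_pow⟩
    · suffices s'.mem (a, i) = s.mem (a, i) by
        rw [this]
        exact h.near a i
      by_cases ha : a = vecA
      · subst ha
        exact hvec' i (by omega)
      by_cases hi₀ : i = 0
      · refine hF.mem a (fun ha' => ?_) i
        have : ∀ a ∈ outputNext.arrays, a = vecA ∨ a = countR ∨ a = entryR ∨ a = rowR ∨
          a = restR ∨ a = digitR := by decide
        have := this a ha'
        tauto
      · refine hF.scalar a (fun ha' => ha ?_) i hi₀
        have : ∀ a ∈ outputNext.indexed, a = vecA := by decide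
        exact this a ha'

/-- There are at most 20 * (N + 1) changed cells. Array names below 20 fit into 5 bits; indices and
contents are at most 2^N and fit into N + 1 bits. -/
theorem Enumerated.bounded {φ : XorCNF} {N r A B K : ℕ} {e : ℕ → ℕ → ZMod 2} {p : ℕ → ℕ}
    {M : Mem} {s : State} (h : Enumerated φ N r e p M K s) (hM : Bounded A B M) :
    Bounded (A + 20 * (N + 1)) (B + N + 5) s.mem := by
  have hsize : ∀ {n}, n ≤ 2 ^ N → Nat.size n ≤ N + 1 := fun {n} hn => by
    rw [Nat.size_le, pow_succ]
    have := Nat.one_le_two_pow (n := N)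
    omega
  refine ⟨?_, ?_, ?_, ?_⟩
  · refine (Finset.card_le_card (t := M.support ∪ Finset.range 20 ×ˢ Finset.range (N + 1))
      fun x hx => ?_).trans ((Finset.card_union_le _ _).trans ?_)
    · rw [Finsupp.mem_support_iff] at hx
      rw [Finset.mem_union, Finsupp.mem_support_iff, Finset.mem_product, Finset.mem_range,
        Finset.mem_range]
      rcases h.near x.1 x.2 with h | h
      · exact .inl (by rwa [← h])
      · exact .inr ⟨h.1, Nat.lt_succ_of_le h.2.1⟩
    · rw [Finset.card_product, Finset.card_range, Finset.card_range]
      exact Nat.add_le_add_right hM.card _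
  · intro x hx
    rcases h.near x.1 x.2 with h | h
    · exact (hM.array x (by rwa [← h])).trans (by omega)
    · have : Nat.size x.1 ≤ 5 := Nat.size_le.2 (h.1.trans (by norm_num))
      omega
  · intro x hx
    rcases h.near x.1 x.2 with h | h
    · exact (hM.index x (by rwa [← h])).trans (by omega)
    · have := hsize (h.2.1.trans Nat.lt_two_pow_self.le)
      omega
  · intro x
    rcases h.near x.1 x.2 with h | h
    · rw [h]
      exact (hM.value x).trans (by omega)
    · exact (hsize h.2.2).trans (by omega)

theorem guard_eval {φ : XorCNF} {N r K : ℕ} {e : ℕ → ℕ → ZMod 2} {p : ℕ → ℕ}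
    {M : Mem} {s : State} (h : Enumerated φ N r e p M K s) :
    guard.eval s.mem = 2 ^ r - K := by
  simp [guard, Expr.eval, h.basis.rank, h.basis.pow r le_rfl, h.count]

/-- Induction on the number d of signatures still to come. `Progress` is proved along with
`Segmented`, because prepending a segment requires progress in the one that follows. -/
theorem segmented_of_enumerated {φ : XorCNF} {N r A B D g : ℕ} {e : ℕ → ℕ → ZMod 2} {p : ℕ → ℕ}
    {M : Mem} (hN : φ.length ≤ N) (hr : r ≤ N)
    (hM : Bounded A B M) (hD : outputNext.time.eval N + 1 ≤ D) (hg : outputNext.growth ≤ g)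
    (d : ℕ) : ∀ K s, K + d = 2 ^ r → Enumerated φ N r e p M K s →
      Segmented D ((A + 20 * (N + 1) + D) * (3 * (B + N + 5 + D * g)))
        ((List.range (2 ^ r)).map (φ.nthSignature e r)) (s.config [.loop guard outputNext]) ∧
      Progress D (s.config [.loop guard outputNext]) := by
  induction d with
  | zero =>
    intro K s hK h
    have hstep : step^[1] (s.config [.loop guard outputNext]) = s.config [] := by
      simp [State.config, step, guard_eval h, ← hK]
    refine ⟨Segmented.prepend (n := 1) (by omega) (h.bounded hM)
      (by simpa [State.config, Prog.growth]) ?_ ?_, 1, by omega, .inr (by rw [hstep]; rfl)⟩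
    · rw [hstep, ← hK, add_zero, ← h.out]
      refine Segmented.of_halted (c := s.config []) rfl
        ((Bounded.space_le (c := s.config []) (h.bounded hM)).trans ?_)
      exact Nat.mul_le_mul (by omega) (by omega)
    · exact ⟨0, Nat.zero_le _, .inr (by rw [hstep]; rfl)⟩
  | succ d ih =>
    intro K s hK h
    obtain ⟨t, ht, s', h', -, hrun⟩ := outputNext_spec hN hr (by omega) h
    have hstep : step^[t + 1] (s.config [.loop guard outputNext]) =
        s'.config [.loop guard outputNext] := by
      rw [Function.iterate_succ_apply, ← hrun]
      congr 1
      simp only [State.config, step, guard_eval h]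
      rw [if_pos (by omega)]
    obtain ⟨ih₁, ih₂⟩ := ih (K + 1) s' (by omega) h'
    refine ⟨Segmented.prepend (n := t + 1) (by omega) (h.bounded hM)
      (by simpa [State.config, Prog.growth]) ?_ ?_, t + 1, by omega, .inl ?_⟩
    · rwa [hstep]
    · rwa [hstep]
    · rw [hstep]
      simp [State.config, h.out, h'.out]

theorem nthSignature_nodup {φ : XorCNF} {r : ℕ} {e : ℕ → ℕ → ZMod 2} {p : ℕ → ℕ}
    (ht : Triangular φ.length r e p) :
    ((List.range (2 ^ r)).map (φ.nthSignature e r)).Nodup := by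
  refine List.Nodup.map_on (fun K hK K' hK' heq => ?_) List.nodup_range
  refine ht.digitSum_injOn (List.mem_range.1 hK) (List.mem_range.1 hK') fun j hj => ?_
  have := List.map_inj_left.1 heq j (List.mem_range.2 hj)
  -- The common base vector cancels.
  have key : ∀ u v w : ZMod 2, decide (u + v ≠ 0) = decide (u + w ≠ 0) → v = w := by decide
  exact key _ _ _ this

theorem mem_nthSignature_iff {φ : XorCNF} {r : ℕ} {e : ℕ → ℕ → ZMod 2}
    (hspan : Submodule.span (ZMod 2) (e '' Set.Iio r) =
      Submodule.span (ZMod 2) (φ.column '' {x | x ∈ φ.encode})) :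
    {b | b ∈ (List.range (2 ^ r)).map (φ.nthSignature e r)} = φ.signatures := by
  rw [signatures_eq, ← hspan]
  ext b
  simp only [Set.mem_ofPred_eq, List.mem_map, List.mem_range, Set.mem_image, SetLike.mem_coe]
  constructor
  · rintro ⟨K, -, rfl⟩
    exact ⟨_, digitSum_mem_span e K r, rfl⟩
  · rintro ⟨u, hu, rfl⟩
    obtain ⟨K, hK, rfl⟩ := exists_digitSum_eq hu
    exact ⟨K, hK, rfl⟩

end XorCNF

namespace RAM

theorem length_le_inputSize (w : List ℕ) : w.length ≤ inputSize w := by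
  induction w with
  | nil => simp
  | cons n w ih =>
    simp only [inputSize, List.map_cons, List.sum_cons, List.length_cons] at *
    omega

theorem size_getD_le_inputSize (w : List ℕ) (i : ℕ) : Nat.size (w.getD i 0) ≤ inputSize w := by
  induction w generalizing i with
  | nil => simp
  | cons n w ih =>
    cases i with
    | zero =>
      simp only [inputSize, List.map_cons, List.sum_cons, List.getD_cons_zero]
      omega
    | succ i =>
      have := ih i
      simp only [inputSize, List.map_cons, List.sum_cons, List.getD_cons_succ] at *
      omega

theorem inputMem_apply (w : List ℕ) (a i : ℕ) :
    inputMem w (a, i) = if a = 0 then w.getD i 0 else 0 := rfl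

/-- The separator bit in `inputSize` makes the number of cells, and hence each index, at most the
input size. -/
theorem inputMem_bounded (w : List ℕ) : Bounded (inputSize w) (inputSize w) (inputMem w) := by
  have key : ∀ x, inputMem w x ≠ 0 → x.1 = 0 ∧ x.2 < w.length := by
    rintro ⟨a, i⟩ hx
    rw [inputMem_apply] at hx
    by_contra h
    apply hx
    split_ifs with ha
    · exact List.getD_eq_default _ _ (by simpa [ha] using h)
    · rfl
  refine ⟨?_, fun x hx => ?_, fun x hx => ?_, fun ⟨a, i⟩ => ?_⟩
  · refine (Finset.card_le_card (t := {0} ×ˢ Finset.range w.length) fun x hx => ?_).trans ?_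
    · have := key x (Finsupp.mem_support_iff.1 hx)
      rwa [Finset.mem_product, Finset.mem_singleton, Finset.mem_range]
    · simpa using length_le_inputSize w
  · simp [(key x hx).1]
  · exact Nat.size_le.2 (((key x hx).2.trans_le (length_le_inputSize w)).trans Nat.lt_two_pow_self)
  · rw [inputMem_apply]
    split_ifs
    · exact size_getD_le_inputSize w i
    · simp

end RAM

/-! ### Assembling preparation and enumeration -/

namespace XorCNF

open RAM

theorem enumerate_segmented (φ : XorCNF) {N D : ℕ} (hN : N = inputSize φ.encode)
    (hD : prepare.time.eval N + outputNext.time.eval N + 1 ≤ D) :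
    ∃ o : List (List Bool), o.Nodup ∧ {b | b ∈ o} = φ.signatures ∧
      Segmented D ((N + D + 20 * (N + 1) + D) *
        (3 * (N + D * enumerate.growth + N + 5 + D * enumerate.growth))) o
        ⟨[enumerate], inputMem φ.encode, [], []⟩ := by
  have hlen : φ.encode.length ≤ N := hN ▸ length_le_inputSize _
  have hB : Bounded N N (inputMem φ.encode) := hN ▸ inputMem_bounded _
  obtain ⟨t, ht, s, ⟨r, hr, e, p, hb, htri, hspan, hbase⟩, hF, hrun⟩ :=
    prepare_spec (N := N) (φ := φ) (s := ⟨inputMem φ.encode, [], []⟩)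
      (fun i => by simp [inputMem_apply]) hlen (fun a ha i => by simp [inputMem_apply, ha])
  have hstep : step^[t + 1] ⟨[enumerate], inputMem φ.encode, [], []⟩ =
      s.config [.loop guard outputNext] := by
    rw [Function.iterate_succ_apply, ← hrun]
    rfl
  -- The preparation takes at most D steps, so the memory it leaves is bounded by its running time;
  -- this memory is the reference for all later segments.
  have hM : Bounded (N + D) (N + D * enumerate.growth) s.mem := by
    have := (iterate_step_bounded (c := ⟨[enumerate], inputMem φ.encode, [], []⟩)
      (g := enumerate.growth) hB (by simp) (t + 1)).1
    rw [hstep] at this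
    exact this.mono (by omega) (by gcongr; omega)
  have hE : Enumerated φ N r e p s.mem 0 s := by
    refine ⟨fun i => ?_, hb, hbase, ?_, ?_, ?_, fun _ _ => .inl rfl⟩
    · rw [hF.mem 0 (by decide)]
      simp [inputMem_apply]
    · rw [hF.mem 17 (by decide)]
      simp [inputMem_apply]
    · rw [hF.buf (by decide)]
    · rw [hF.out (by decide)]
      simp
  obtain ⟨h₁, h₂⟩ := segmented_of_enumerated (D := D) (g := enumerate.growth)
    (φ.length_le_length_encode.trans hlen) hr hM (by omega)
    (by simp [enumerate, Prog.growth]) (2 ^ r) 0 s (by simp) hE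
  -- The preparation is one more segment. The bounds for the initial memory are weakened to those of
  -- the enumeration, so that the same space bound serves for both.
  refine ⟨_, nthSignature_nodup htri, mem_nthSignature_iff hspan,
    Segmented.prepend (n := t + 1) (by omega) (hB.mono (by omega) (by omega)) (by simp) ?_ ?_⟩
  · rwa [hstep]
  · rwa [hstep]

end XorCNF

theorem theorem1p1 :
    RAM.EnumerableWithPolyDelayPolySpace XorCNF.encode XorCNF.signatures := by
  let D : Polynomial ℕ := XorCNF.prepare.time + XorCNF.outputNext.time + 1
  let g : Polynomial ℕ := .C XorCNF.enumerate.growth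
  -- The space polynomial is the bound of `enumerate_segmented` with N as the indeterminate; D
  -- bounds the length of every segment, and the delay is twice that.
  refine ⟨XorCNF.enumerate, 2 * D, (.X + D + 20 * (.X + 1) + D) *
    (3 * (.X + D * g + .X + 5 + D * g)), fun φ => ?_⟩
  obtain ⟨o, hnodup, hset, h⟩ := φ.enumerate_segmented rfl
    (D := D.eval (RAM.inputSize φ.encode)) (by simp [D])
  refine ⟨?_, fun t => ?_, fun t => ?_⟩
  · obtain ⟨T, hT, rfl⟩ := h.halts
    exact ⟨T, hT, hnodup, hset⟩
  · simpa [RAM.run] using h.delay t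
  · simpa [RAM.run, g] using h.space t
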